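/- **Setting.** Let $G=(U\cup V,E)$ be a finite bipartite graph, $E\subseteq U\times V$, with left-nodes $U$ and right-nodes $V$. Write $N(w)$ for the set of edges at a node $w$ and $x(F)=\sum_{e\in F}x_e$ for $F\subseteq E$ (similarly $\rho(F)$). Let $x,\rho\in[0,1]^E$ satisfy $x(N(v))\le 1$ for every $v\in V$ and $\rho(N(u))\le 1$ for every $u\in U$. To exclude degenerate expressions, assume $x_e>0$ and $0<\rho_e<1$ for every edge $e$, and $x_e<x(N(v))$ for every edge $e$ with right-node $v$, unless $x_e=1$. For $a,b>0$ and $z\in[0,1]$ let $I(z;a,b)=\int_0^z t^{a-1}(1-t)^{b-1}\,dt\,\big/\,\frac{\Gamma(a)\Gamma(b)}{\Gamma(a+b)}$ be the regularized incomplete Beta function, and let $\mathrm{Dir}$ denote the Dirichlet distribution (a parameter $0$ means that the corresponding coordinate is $0$). For $x_1,x_2\in(0,1]$ and $\rho_1,\rho_2\in(0,1)$ with $\rho_1+\rho_2\le 1$ put $$\Psi(x_1,x_2;\rho_1,\rho_2)=\frac{1}{x_1x_2}\,\mathbb E\Bigl[I(T_1;\rho_1,1-\rho_1)^{1/x_1-1}\,I(T_2;\rho_2,1-\rho_2)^{1/x_2-1}\Bigr],\qquad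 (T_1,T_2,T_0)\sim \mathrm{Dir}(\rho_1,\rho_2,1-\rho_1-\rho_2).$$ **Algorithm DepRound$(G,x,\rho)$.** Independently for each left-node $u$, draw $(T_e)_{e\in N(u)}$ as the coordinates, other than the last, of a vector distributed as $\mathrm{Dir}\bigl((\rho_e)_{e\in N(u)},\,1-\rho(N(u))\bigr)$. For each edge $e$ set $A_e=I(T_e;\rho_e,1-\rho_e)$ and $Z_e=-\log(A_e)/x_e$. For each edge $e$ with right-node $v$ set $X_e=1$ if $$(1-x_e)\,Z_e<(x(N(v))-x_e)\min_{f\in N(v)\setminus\{e\}}Z_f ,$$ (a condition regarded as satisfied if $N(v)=\{e\}$, in which case $x_e=1$), and $X_e=0$ otherwise. A set $S\subseteq E$ is *stable* if no two of its edges have distance exactly two in the line graph of $G$. A finite family of random variables is *negatively associated* if any two coordinatewise increasing functions of disjoint subfamilies have nonpositive covariance (whenever it exists). **Theorem.** 1. For every right-node $v$, the random variables $Z_e$, $e\in N(v)$, are independent exponentials of respective rates $x_e$. 2. The random variables $A_e$, $e\in E$, are negatively associated. 3. $\Pr[X_e=1]=x_e$ for every edge $e$. 4. Almost surely, every right-node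 $v$ has at most one edge $e\in N(v)$ with $X_e=1$. 5. For every stable edge set $S$, $$\mathbb E\Bigl[\prod_{e\in S}X_e\Bigr]\le \mathbb E\Bigl[\prod_{e\in S}A_e^{1/x_e-1}\Bigr]\le\prod_{e\in S}x_e .$$ 6. For any two distinct edges $e_1,e_2$ with the same left-node, $$\mathbb E[X_{e_1}X_{e_2}]\le x_{e_1}x_{e_2}\,\Psi(x_{e_1},x_{e_2};\rho_{e_1},\rho_{e_2}).$$ -/

import Mathlib

open MeasureTheory ProbabilityTheory
open scoped ENNReal

noncomputable section

/-! ### Dirichlet distribution and its copula -/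

/-- The incomplete Beta function `B(z; a, b) = ∫₀ᶻ t^(a-1) (1-t)^(b-1) dt`. -/
def incompleteBeta (z a b : ℝ) : ℝ :=
  ∫ t in (0 : ℝ)..z, t ^ (a - 1) * (1 - t) ^ (b - 1)

/-- The regularized incomplete Beta function `I(z; a, b) = B(z; a, b) / B(a, b)`. -/
def regIncompleteBeta (z a b : ℝ) : ℝ :=
  incompleteBeta z a b / beta a b

/-- The Gamma distribution with shape `a` and rate `1`, with the usual convention that it is
concentrated at `0` when `a = 0`. -/
def gammaLaw (a : ℝ) : Measure ℝ :=
  if 0 < a then gammaMeasure a 1 else Measure.dirac 0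

/-- The Dirichlet distribution `Dir(ρ₁, …, ρₙ, ρ₀)`, viewed as the law of the vector of its first
`n` coordinates: the law of `(Gᵢ / (∑ⱼ Gⱼ + G₀))ᵢ`, where the `Gᵢ ~ Gamma(ρᵢ)` and `G₀ ~ Gamma(ρ₀)`
are independent.  A parameter may vanish (the corresponding coordinate is then `0`); in particular
`ρ₀ = 0` gives the distribution `Dir(ρ₁, …, ρₙ)` on the simplex `∑ tᵢ = 1`.  For positive
parameters it is the distribution with the usual density, see `dirichlet_eq_withDensity`. -/
def dirichlet {ι : Type*} [Fintype ι] (ρ : ι → ℝ) (ρ₀ : ℝ) : Measure (ι → ℝ) :=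
  ((Measure.pi fun i => gammaLaw (ρ i)).prod (gammaLaw ρ₀)).map
    fun g i => g.1 i / (∑ j, g.1 j + g.2)

theorem pi_gammaMeasure_eq_withDensity {ι : Type*} [Fintype ι] (ρ : ι → ℝ) (hρ : ∀ i, 0 < ρ i) :
    (Measure.pi fun i => gammaMeasure (ρ i) 1) =
      volume.withDensity fun g : ι → ℝ => ∏ i, gammaPDF (ρ i) 1 (g i) := by
  have hp := fun i => isProbabilityMeasure_gammaMeasure (hρ i) one_pos
  refine Measure.pi_eq (μ := fun i => gammaMeasure (ρ i) 1) fun s hs => ?_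
  have hint : ∀ i, Integrable (gammaPDFReal (ρ i) 1) := fun i =>
    ⟨(measurable_gammaPDFReal _ _).aestronglyMeasurable, by
      rw [hasFiniteIntegral_iff_ofReal (.of_forall fun x =>
        gammaPDFReal_nonneg (hρ i) one_pos x)]
      exact (lintegral_gammaPDF_eq_one (hρ i) one_pos).trans_lt ENNReal.one_lt_top⟩
  have h1 := integral_fintype_prod_volume_eq_prod
    (fun i => (s i).indicator (gammaPDFReal (ρ i) 1))
  have h2 : Integrable fun x : ι → ℝ => ∏ i, (s i).indicator (gammaPDFReal (ρ i) 1) (x i) :=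
    Integrable.fintype_prod (μ := fun _ => volume) fun i => (hint i).indicator (hs i)
  have hnn : ∀ i y, 0 ≤ (s i).indicator (gammaPDFReal (ρ i) 1) y := fun i y =>
    Set.indicator_nonneg (fun z _ => gammaPDFReal_nonneg (hρ i) one_pos z) y
  have h3 := congrArg ENNReal.ofReal h1
  rw [ofReal_integral_eq_lintegral_ofReal h2
      (.of_forall fun x => Finset.prod_nonneg fun i _ => hnn i _),
    ENNReal.ofReal_prod_of_nonneg fun i _ => integral_nonneg (hnn i)] at h3
  rw [withDensity_apply _ (MeasurableSet.univ_pi hs),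
    ← lintegral_indicator (MeasurableSet.univ_pi hs)]
  refine Eq.trans (lintegral_congr fun x => ?_) (h3.trans (Finset.prod_congr rfl fun i _ => ?_))
  · symm
    by_cases hx : x ∈ Set.univ.pi s
    · rw [Set.indicator_of_mem hx, ENNReal.ofReal_prod_of_nonneg fun i _ => hnn i _]
      refine Finset.prod_congr rfl fun i _ => ?_
      rw [Set.indicator_of_mem (hx i trivial)]; rfl
    · rw [Set.indicator_of_notMem hx]
      simp only [Set.mem_pi, Set.mem_univ, true_imp_iff, not_forall] at hx
      obtain ⟨i, hi⟩ := hx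
      rw [Finset.prod_eq_zero (Finset.mem_univ i) (Set.indicator_of_notMem hi _),
        ENNReal.ofReal_zero]
  · rw [gammaMeasure, withDensity_apply _ (hs i), ← lintegral_indicator (hs i),
      ofReal_integral_eq_lintegral_ofReal ((hint i).indicator (hs i)) (.of_forall (hnn i))]
    refine lintegral_congr fun y => ?_
    by_cases hy : y ∈ s i <;> simp [hy, gammaPDF]

theorem lintegral_gammaPDF_radial {ι : Type*} [Fintype ι] (ρ : ι → ℝ) (ρ₀ : ℝ) (hρ : ∀ i, 0 < ρ i)
    (h0 : 0 < ρ₀) (t : ι → ℝ) :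
    ∫⁻ s in Set.Ioi (0 : ℝ), ENNReal.ofReal (s ^ Fintype.card ι) *
        ((∏ i, gammaPDF (ρ i) 1 (s * t i)) * gammaPDF ρ₀ 1 (s * (1 - ∑ i, t i))) =
      if (∀ i, 0 ≤ t i) ∧ ∑ i, t i ≤ 1 then
        ENNReal.ofReal (Real.Gamma (∑ i, ρ i + ρ₀) / ((∏ i, Real.Gamma (ρ i)) * Real.Gamma ρ₀) *
          ((1 - ∑ i, t i) ^ (ρ₀ - 1) * ∏ i, t i ^ (ρ i - 1))) else 0 := by
  split_ifs with h
  · obtain ⟨ht, ht1⟩ := h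
    set σ := ∑ i, ρ i + ρ₀ with hσ
    have hσ0 : 0 < σ := add_pos_of_nonneg_of_pos (Finset.sum_nonneg fun i _ => (hρ i).le) h0
    set C := Real.Gamma σ / ((∏ i, Real.Gamma (ρ i)) * Real.Gamma ρ₀) *
          ((1 - ∑ i, t i) ^ (ρ₀ - 1) * ∏ i, t i ^ (ρ i - 1)) with hC
    have hG : 0 < Real.Gamma σ := Real.Gamma_pos_of_pos hσ0
    have hG0 : 0 < Real.Gamma ρ₀ := Real.Gamma_pos_of_pos h0
    have hGi : ∀ i, 0 < Real.Gamma (ρ i) := fun i => Real.Gamma_pos_of_pos (hρ i)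
    have h1t : 0 ≤ 1 - ∑ i, t i := by linarith
    have key : ∀ s ∈ Set.Ioi (0 : ℝ), ENNReal.ofReal (s ^ Fintype.card ι) *
        ((∏ i, gammaPDF (ρ i) 1 (s * t i)) * gammaPDF ρ₀ 1 (s * (1 - ∑ i, t i))) =
        ENNReal.ofReal C * gammaPDF σ 1 s := by
      intro s hs
      have hs : 0 < s := hs
      have hsti : ∀ i, 0 ≤ s * t i := fun i => mul_nonneg hs.le (ht i)
      have e1 : (∏ i, gammaPDF (ρ i) 1 (s * t i)) =
          ENNReal.ofReal (∏ i, gammaPDFReal (ρ i) 1 (s * t i)) :=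
        (ENNReal.ofReal_prod_of_nonneg fun i _ => gammaPDFReal_nonneg (hρ i) one_pos _).symm
      have hC0 : 0 ≤ C := by
        have : 0 ≤ ∏ i, t i ^ (ρ i - 1) :=
          Finset.prod_nonneg fun i _ => Real.rpow_nonneg (ht i) _
        have : 0 < ∏ i, Real.Gamma (ρ i) := Finset.prod_pos fun i _ => hGi i
        positivity
      have hP : 0 ≤ ∏ i, gammaPDFReal (ρ i) 1 (s * t i) :=
        Finset.prod_nonneg fun i _ => gammaPDFReal_nonneg (hρ i) one_pos _
      rw [e1, gammaPDF, gammaPDF, ← ENNReal.ofReal_mul hP, ← ENNReal.ofReal_mul (by positivity),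
        ← ENNReal.ofReal_mul hC0]
      congr 1
      have e2 : (∏ i, gammaPDFReal (ρ i) 1 (s * t i)) =
          (∏ i, Real.Gamma (ρ i))⁻¹ * (s ^ (∑ i, ρ i) / s ^ Fintype.card ι) *
            (∏ i, t i ^ (ρ i - 1)) * Real.exp (-(s * ∑ i, t i)) := by
        have : ∀ i, gammaPDFReal (ρ i) 1 (s * t i) =
            (Real.Gamma (ρ i))⁻¹ * (s ^ (ρ i) / s) * t i ^ (ρ i - 1) * Real.exp (-(s * t i)) := by
          intro i
          rw [gammaPDFReal, if_pos (hsti i), Real.mul_rpow hs.le (ht i), Real.rpow_sub_one hs.ne']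
          simp only [Real.one_rpow, one_mul]; ring
        simp_rw [this, Finset.prod_mul_distrib, Finset.prod_div_distrib, Finset.prod_inv_distrib,
          ← Real.exp_sum, Finset.sum_neg_distrib, ← Finset.mul_sum, Real.rpow_sum_of_pos hs]
        simp
      have e3 : gammaPDFReal ρ₀ 1 (s * (1 - ∑ i, t i)) =
          (Real.Gamma ρ₀)⁻¹ * (s ^ ρ₀ / s) * (1 - ∑ i, t i) ^ (ρ₀ - 1) *
            Real.exp (-(s * (1 - ∑ i, t i))) := by
        rw [gammaPDFReal, if_pos (mul_nonneg hs.le h1t), Real.mul_rpow hs.le h1t,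
          Real.rpow_sub_one hs.ne']
        simp only [Real.one_rpow, one_mul]; ring
      have e4 : gammaPDFReal σ 1 s = (Real.Gamma σ)⁻¹ * (s ^ (∑ i, ρ i) * s ^ ρ₀ / s) *
          (Real.exp (-(s * ∑ i, t i)) * Real.exp (-(s * (1 - ∑ i, t i)))) := by
        rw [gammaPDFReal, if_pos hs.le, Real.rpow_sub_one hs.ne', hσ, Real.rpow_add hs,
          ← Real.exp_add]
        simp only [Real.one_rpow, one_mul]
        ring_nf
      have hpg : (∏ i, Real.Gamma (ρ i)) ≠ 0 := (Finset.prod_pos fun i _ => hGi i).ne'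
      rw [e2, e3, e4, hC]
      field_simp
    rw [setLIntegral_congr_fun measurableSet_Ioi key, lintegral_const_mul _
      (show Measurable (gammaPDF σ 1) from (measurable_gammaPDFReal _ _).ennreal_ofReal)]
    have : ∫⁻ s in Set.Ioi (0 : ℝ), gammaPDF σ 1 s = 1 := by
      have h := lintegral_add_compl (μ := volume) (gammaPDF σ 1)
        (measurableSet_Ici (a := (0 : ℝ)))
      rw [Set.compl_Ici, lintegral_gammaPDF_of_nonpos le_rfl, add_zero,
        lintegral_gammaPDF_eq_one hσ0 one_pos] at h
      rw [setLIntegral_congr Ioi_ae_eq_Ici, h]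
    rw [this, mul_one]
  · rw [setLIntegral_congr_fun (g := fun _ => 0) measurableSet_Ioi, lintegral_zero]
    intro s hs
    have hs : 0 < s := hs
    simp only [mul_eq_zero]
    right
    by_contra! hne
    apply h
    constructor
    · intro i
      by_contra! hi
      exact hne.1 (Finset.prod_eq_zero (Finset.mem_univ i)
        (gammaPDF_of_neg (mul_neg_of_pos_of_neg hs hi)))
    · by_contra! hi
      exact hne.2 (gammaPDF_of_neg (mul_neg_of_pos_of_neg hs (by linarith)))

/-- For positive parameters, `dirichlet ρ ρ₀` is the distribution on `{t ≥ 0, ∑ tᵢ ≤ 1}` with density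
`B(ρ₁, …, ρₙ, ρ₀)⁻¹ (1 - ∑ tᵢ)^(ρ₀-1) ∏ tᵢ^(ρᵢ-1)`. -/
theorem dirichlet_eq_withDensity {ι : Type*} [Fintype ι] (ρ : ι → ℝ) (ρ₀ : ℝ)
    (hρ : ∀ i, 0 < ρ i) (h0 : 0 < ρ₀) :
    dirichlet ρ ρ₀ = volume.withDensity fun t =>
      if (∀ i, 0 ≤ t i) ∧ ∑ i, t i ≤ 1 then
        ENNReal.ofReal (Real.Gamma (∑ i, ρ i + ρ₀) / ((∏ i, Real.Gamma (ρ i)) * Real.Gamma ρ₀) *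
          ((1 - ∑ i, t i) ^ (ρ₀ - 1) * ∏ i, t i ^ (ρ i - 1))) else 0 := by
  have mpdf : ∀ a, Measurable (gammaPDF a 1) := fun a =>
    (measurable_gammaPDFReal a 1).ennreal_ofReal
  have hfib := isProbabilityMeasure_gammaMeasure h0 one_pos
  have hpf := fun i => isProbabilityMeasure_gammaMeasure (hρ i) one_pos
  have hmeas : Measurable fun (g : (ι → ℝ) × ℝ) (i : ι) => g.1 i / (∑ j, g.1 j + g.2) := by
    fun_prop
  have hmd : Measurable fun g : ι → ℝ => ∏ i, gammaPDF (ρ i) 1 (g i) :=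
    Finset.measurable_prod _ fun i _ => (mpdf _).comp (measurable_pi_apply i)
  ext s hs
  rw [withDensity_apply _ hs, ← lintegral_indicator hs]
  rw [← lintegral_indicator_one hs, dirichlet]
  simp only [gammaLaw, hρ, h0, if_true]
  rw [lintegral_map (measurable_one.indicator hs) hmeas, pi_gammaMeasure_eq_withDensity ρ hρ, gammaMeasure,
    prod_withDensity hmd (mpdf _)]
  refine (lintegral_withDensity_eq_lintegral_mul _ (by fun_prop)
      ((measurable_one.indicator hs).comp hmeas)).trans ?_
  simp only [Pi.mul_apply, Function.comp_apply]
  set φ : (ι → ℝ) → ℝ≥0∞ := s.indicator 1 with hφ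
  have mφ : Measurable φ := measurable_one.indicator hs
  set P : (ι → ℝ) → ℝ≥0∞ := fun g => ∏ i, gammaPDF (ρ i) 1 (g i) with hP
  have mP : Measurable P := hmd
  rw [lintegral_prod _ (by fun_prop)]
  calc ∫⁻ g : ι → ℝ, ∫⁻ y : ℝ, P g * gammaPDF ρ₀ 1 y * φ (fun i => g i / (∑ j, g j + y))
      = ∫⁻ g : ι → ℝ, ∫⁻ s : ℝ, P g * gammaPDF ρ₀ 1 (s - ∑ j, g j) * φ (fun i => g i / s) := by
        refine lintegral_congr fun g => ?_
        rw [← lintegral_sub_right_eq_self _ (∑ j, g j)]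
        refine lintegral_congr fun y => ?_
        simp
    _ = ∫⁻ s : ℝ, ∫⁻ g : ι → ℝ, P g * gammaPDF ρ₀ 1 (s - ∑ j, g j) * φ (fun i => g i / s) :=
        lintegral_lintegral_swap (by fun_prop)
    _ = ∫⁻ s in Set.Ioi (0:ℝ), ∫⁻ g : ι → ℝ,
          P g * gammaPDF ρ₀ 1 (s - ∑ j, g j) * φ (fun i => g i / s) := by
        rw [setLIntegral_congr Ioi_ae_eq_Ici, ← lintegral_add_compl _ (measurableSet_Ici (a := (0:ℝ)))]
        convert add_zero _
        rw [setLIntegral_congr_fun (g := fun _ => 0) measurableSet_Ici.compl, lintegral_zero]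
        intro s hs
        have hs : s < 0 := by simpa using hs
        simp only
        rw [lintegral_congr (g := fun _ => 0), lintegral_zero]
        intro g
        by_cases hg : ∀ i, 0 ≤ g i
        · rw [gammaPDF_of_neg (by linarith [Finset.sum_nonneg fun i (_ : i ∈ Finset.univ) => hg i])]
          simp
        · push Not at hg
          obtain ⟨i, hi⟩ := hg
          simp only [hP]
          rw [Finset.prod_eq_zero (Finset.mem_univ i) (gammaPDF_of_neg hi)]
          simp
    _ = ∫⁻ s in Set.Ioi (0:ℝ), ∫⁻ t : ι → ℝ, ENNReal.ofReal (s ^ Fintype.card ι) *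
          ((∏ i, gammaPDF (ρ i) 1 (s * t i)) * gammaPDF ρ₀ 1 (s * (1 - ∑ i, t i))) * φ t := by
        refine setLIntegral_congr_fun measurableSet_Ioi fun s hs => ?_
        have hs : 0 < s := hs
        have hm := Measure.map_addHaar_smul (volume : Measure (ι → ℝ)) (inv_ne_zero hs.ne')
        have hv : (volume : Measure (ι → ℝ)) = ENNReal.ofReal (s ^ Fintype.card ι) •
            Measure.map (s • ·) volume := by
          rw [Measure.map_addHaar_smul (volume : Measure (ι → ℝ)) hs.ne', smul_smul,
            ← ENNReal.ofReal_mul (by positivity), abs_of_pos (by positivity),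
            Module.finrank_fintype_fun_eq_card, mul_inv_cancel₀ (by positivity)]
          simp
        conv_lhs => rw [hv]
        rw [lintegral_smul_measure, lintegral_map (by fun_prop) (by fun_prop), smul_eq_mul,
          ← lintegral_const_mul _ (by fun_prop)]
        refine lintegral_congr fun t => ?_
        have e1 : (fun i => (s • t) i / s) = t := by
          ext i; simp [hs.ne']
        rw [e1]
        simp only [hP, Pi.smul_apply, smul_eq_mul, ← Finset.mul_sum, mul_sub, mul_one]
        ring
    _ = ∫⁻ t : ι → ℝ, ∫⁻ s in Set.Ioi (0:ℝ), ENNReal.ofReal (s ^ Fintype.card ι) *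
          ((∏ i, gammaPDF (ρ i) 1 (s * t i)) * gammaPDF ρ₀ 1 (s * (1 - ∑ i, t i))) * φ t := by
        refine lintegral_lintegral_swap (Measurable.aemeasurable ?_)
        have : ∀ i, Measurable fun p : ℝ × (ι → ℝ) => gammaPDF (ρ i) 1 (p.1 * p.2 i) :=
          fun i => (mpdf _).comp (by fun_prop)
        have h2 := Finset.measurable_prod Finset.univ fun i _ => this i
        have h3 : Measurable fun p : ℝ × (ι → ℝ) => gammaPDF ρ₀ 1 (p.1 * (1 - ∑ i, p.2 i)) :=
          (mpdf _).comp (by fun_prop)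
        simp only [Function.uncurry_def]
        fun_prop
    _ = _ := by
        refine lintegral_congr fun t => ?_
        have : Measurable fun s : ℝ => ENNReal.ofReal (s ^ Fintype.card ι) *
          ((∏ i, gammaPDF (ρ i) 1 (s * t i)) * gammaPDF ρ₀ 1 (s * (1 - ∑ i, t i))) := by
          fun_prop
        rw [lintegral_mul_const _ this, lintegral_gammaPDF_radial ρ ρ₀ hρ h0]
        by_cases ht : t ∈ s <;> simp [hφ, ht]

/-- The correlation function
`Ψ(x₁, x₂; ρ₁, ρ₂) = E[I(T₁; ρ₁, 1-ρ₁)^(1/x₁-1) I(T₂; ρ₂, 1-ρ₂)^(1/x₂-1)] / (x₁ x₂)`,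
where `(T₁, T₂) ~ Dir(ρ₁, ρ₂, 1-ρ₁-ρ₂)`. -/
def Psi (x₁ x₂ ρ₁ ρ₂ : ℝ) : ℝ :=
  (∫ t : Fin 2 → ℝ, regIncompleteBeta (t 0) ρ₁ (1 - ρ₁) ^ (1 / x₁ - 1) *
      regIncompleteBeta (t 1) ρ₂ (1 - ρ₂) ^ (1 / x₂ - 1)
    ∂(dirichlet ![ρ₁, ρ₂] (1 - ρ₁ - ρ₂))) / (x₁ * x₂)

/-- A finite family of random variables is negatively associated if increasing functions of
disjoint subfamilies have nonpositive covariance, whenever this covariance exists. -/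
def NegativelyAssociated {Ω ι : Type*} [MeasurableSpace Ω] (X : ι → Ω → ℝ) (μ : Measure Ω) :
    Prop :=
  ∀ s t : Set ι, Disjoint s t → ∀ (f : (s → ℝ) → ℝ) (g : (t → ℝ) → ℝ),
    Monotone f → Monotone g → Measurable f → Measurable g →
    Integrable (fun ω => f fun i => X i ω) μ →
    Integrable (fun ω => g fun i => X i ω) μ →
    Integrable (fun ω => (f fun i => X i ω) * g fun i => X i ω) μ →
    covariance (fun ω => f fun i => X i ω) (fun ω => g fun i => X i ω) μ ≤ 0

/-! ### Bipartite graphs: left-nodes `U`, right-nodes `V`, edge set `E ⊆ U × V` -/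

section Graph

variable {U V : Type*} (E : Finset (U × V))

/-- `N(u)`, the set of edges at the left-node `u`. -/
abbrev LeftNbr (u : U) : Type _ := {e : E // e.1.1 = u}

/-- `N(v)`, the set of edges at the right-node `v`. -/
abbrev RightNbr (v : V) : Type _ := {e : E // e.1.2 = v}

/-- The line graph: two distinct edges are adjacent if they share an endpoint. -/
def edgeLineGraph : SimpleGraph E where
  Adj e f := e ≠ f ∧ (e.1.1 = f.1.1 ∨ e.1.2 = f.1.2)
  symm := ⟨fun _ _ h => ⟨h.1.symm, h.2.imp Eq.symm Eq.symm⟩⟩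
  loopless := ⟨fun _ h => h.1 rfl⟩

/-- A set of edges is stable if no two of its edges are at distance exactly two in the line
graph. -/
def StableEdgeSet (S : Finset E) : Prop :=
  ∀ e ∈ S, ∀ f ∈ S, (edgeLineGraph E).dist e f ≠ 2

end Graph

/-! ### The rounding algorithm `DepRound(G, x, ρ)` -/

namespace DepRound

variable {U V : Type*} [DecidableEq U] [DecidableEq V] (E : Finset (U × V))

/-- The random choices of the algorithm: a vector `(T_e)_{e ∈ N(u)}` for every left-node `u`. -/
abbrev Sample : Type _ := ∀ u : U, LeftNbr E u → ℝ

/-- The law of the random choices: independently over the left-nodes `u`, the vector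
`(T_e)_{e ∈ N(u)}` is drawn from `Dir((ρ_e)_{e ∈ N(u)}, 1 - ρ(N(u)))`. -/
def law [Fintype U] (ρ : E → ℝ) : Measure (Sample E) :=
  Measure.pi fun u => dirichlet (fun e : LeftNbr E u => ρ e) (1 - ∑ e : LeftNbr E u, ρ e)

/-- `T_e`. -/
def T (e : E) (ω : Sample E) : ℝ := ω e.1.1 ⟨e, rfl⟩

/-- `A_e = I(T_e; ρ_e, 1 - ρ_e)`. -/
def A (ρ : E → ℝ) (e : E) (ω : Sample E) : ℝ :=
  regIncompleteBeta (T E e ω) (ρ e) (1 - ρ e)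

/-- `Z_e = -log(A_e) / x_e`. -/
def Z (x ρ : E → ℝ) (e : E) (ω : Sample E) : ℝ := -Real.log (A E ρ e ω) / x e

/-- `x(N(v))`, the total weight at the right-node `v`. -/
def rightWeight (x : E → ℝ) (v : V) : ℝ := ∑ e : RightNbr E v, x e

open Classical in
/-- The output `X_e` for the edge `e` with right-node `v`: it is `1` if
`(1 - x_e) Z_e < (x(N(v)) - x_e) · min_{f ∈ N(v) \ {e}} Z_f`, that is, if the inequality holds
for every `f ∈ N(v) \ {e}`, and `0` otherwise. -/
def X (x ρ : E → ℝ) (e : E) (ω : Sample E) : ℝ :=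
  if ∀ f : E, f.1.2 = e.1.2 → f ≠ e →
      (1 - x e) * Z E x ρ e ω < (rightWeight E x e.1.2 - x e) * Z E x ρ f ω
  then 1 else 0

end DepRound

end

noncomputable section

set_option linter.unusedSectionVars false

/-! Everything rests on the Gamma representation of the Dirichlet law. Independent Gamma variables
of equal rate have a total independent of their proportions: weighting by an exponential of the
total amounts to rescaling all variables, which leaves the proportions unchanged
(`map_proportions_total_gammaProd`). Hence, for any set s of coordinates, a Dirichlet vector splits
as (r d, (1 - r) d') with r, d, d' independent (`exists_lintegral_dirichlet_split`). Increasing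
functions of the two blocks have conditional means that are monotone in r in opposite directions, so
Chebyshev's inequality gives negative association (`negAssocLaw_dirichlet`), and integrating out one
left-node at a time carries it to the whole sample (`lmarginal_mul_le`).

At a left-node the Dirichlet parameters, the last one included, sum to 1. So T_e has law Beta(ρ_e, 1
- ρ_e), and A_e, its distribution function at T_e, is uniform. This makes Z_e exponential. Edges at
a right-node have distinct left-nodes, whence their independence.

After taking logarithms, X_e = 1 says that A_f < A_e ^ c_ef for every competitor f at the right-node
of e, and the exponents c_ef sum to 1/x_e - 1 (`sum_expo`). Given A_e, the independent uniform
competitors achieve this with probability A_e ^ (1/x_e - 1), whose mean is x_e.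

Let S be stable. If two of its edges share a right-node, the product of the X_e vanishes almost
surely. Otherwise no competitor shares a left-node with an edge of S. Conditionally on the
left-nodes of S, the indicators are then decreasing functions of distinct negatively associated
variables, which gives the bound by the product of the A_e ^ (1/x_e - 1)
(`lintegral_prod_belowInd_le`). Negative association once more bounds the mean of that product by
the product of the x_e. Two edges at a left-node are adjacent, hence form a stable set, and the
two-coordinate Dirichlet marginal evaluates the middle term as x₁ x₂ Ψ. -/

/-! ### Uniqueness of Laplace transforms -/

/-- Two finite measures on `ℝ` whose moment generating functions are finite and agree near `0`
are equal. -/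
theorem ext_of_lintegral_exp_eq {μ ν : Measure ℝ} [IsFiniteMeasure μ] [IsFiniteMeasure ν]
    {δ : ℝ} (hδ : 0 < δ)
    (hfin : ∀ t ∈ Set.Ioo (-δ) δ, ∫⁻ y, ENNReal.ofReal (Real.exp (t * y)) ∂ν ≠ ∞)
    (h : ∀ t ∈ Set.Ioo (-δ) δ, ∫⁻ y, ENNReal.ofReal (Real.exp (t * y)) ∂μ =
      ∫⁻ y, ENNReal.ofReal (Real.exp (t * y)) ∂ν) : μ = ν := by
  have sub : ∀ {m : Measure ℝ} [IsFiniteMeasure m],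
      (∀ t ∈ Set.Ioo (-δ) δ, ∫⁻ y, ENNReal.ofReal (Real.exp (t * y)) ∂m ≠ ∞) →
      Set.Ioo (-δ) δ ⊆ interior (integrableExpSet id m) := by
    intro m _ hm
    refine isOpen_Ioo.subset_interior_iff.2 fun t ht => ?_
    refine ⟨by fun_prop, ?_⟩
    rw [hasFiniteIntegral_iff_ofReal (.of_forall fun y => (Real.exp_pos _).le)]
    exact (hm t ht).lt_top
  have hμ := sub fun t ht => (h t ht).trans_ne (hfin t ht)
  have hν := sub hfin
  have mgf_eq : ∀ t ∈ Set.Ioo (-δ) δ, mgf id μ t = mgf id ν t := by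
    intro t ht
    simp only [mgf, id]
    rw [integral_eq_lintegral_of_nonneg_ae (.of_forall fun y => (Real.exp_pos _).le) (by fun_prop),
      integral_eq_lintegral_of_nonneg_ae (.of_forall fun y => (Real.exp_pos _).le) (by fun_prop),
      h t ht]
  -- On this vertical strip both complex transforms are analytic. They agree at real points
  -- accumulating at 0, hence on the whole strip, and on the imaginary axis they are the
  -- characteristic functions.
  set W : Set ℂ := {z | z.re ∈ Set.Ioo (-δ) δ} with hW
  have hX : AnalyticOnNhd ℂ (complexMGF id μ) W :=
    analyticOnNhd_complexMGF.mono fun z hz => hμ hz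
  have hY : AnalyticOnNhd ℂ (complexMGF id ν) W :=
    analyticOnNhd_complexMGF.mono fun z hz => hν hz
  have key : Set.EqOn (complexMGF id μ) (complexMGF id ν) W := by
    refine AnalyticOnNhd.eqOn_of_preconnected_of_frequently_eq hX hY
      ((convex_Ioo (-δ) δ).linear_preimage Complex.reLm).isPreconnected
      (z₀ := ((0 : ℝ) : ℂ)) (by simp [hW, hδ]) ?_
    have h_real : ∃ᶠ (y : ℝ) in nhdsWithin 0 {0}ᶜ, complexMGF id μ y = complexMGF id ν y := by
      refine Filter.Eventually.frequently ?_
      filter_upwards [nhdsWithin_le_nhds (Ioo_mem_nhds (neg_lt_zero.2 hδ) hδ)] with y hy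
      rw [complexMGF_ofReal, complexMGF_ofReal, mgf_eq y hy]
    rw [Filter.frequently_iff_seq_forall] at h_real ⊢
    obtain ⟨xs, hx_tendsto, hx_eq⟩ := h_real
    refine ⟨fun n => xs n, ?_, fun n => by simp [hx_eq]⟩
    rw [tendsto_nhdsWithin_iff] at hx_tendsto ⊢
    exact ⟨(Complex.continuous_ofReal.tendsto 0).comp hx_tendsto.1, by simpa using hx_tendsto.2⟩
  refine Measure.ext_of_charFun (funext fun t => ?_)
  rw [← complexMGF_id_mul_I, ← complexMGF_id_mul_I]
  exact key (by simp [hW, hδ])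

/-! ### Scaling of Gamma laws and independence of the total and the proportions -/

instance isProbabilityMeasure_gammaLaw (a : ℝ) : IsProbabilityMeasure (gammaLaw a) := by
  unfold gammaLaw
  split_ifs with h
  · exact isProbabilityMeasure_gammaMeasure h one_pos
  · infer_instance

theorem gammaLaw_zero : gammaLaw 0 = Measure.dirac 0 := by simp [gammaLaw]

theorem gammaLaw_ae_nonneg (a : ℝ) : ∀ᵐ y ∂gammaLaw a, 0 ≤ y := by
  unfold gammaLaw
  split_ifs with h
  · rw [ae_iff, gammaMeasure]
    simp only [not_le]
    change (volume.withDensity (gammaPDF a 1)) (Set.Iio 0) = 0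
    rw [withDensity_apply _ measurableSet_Iio]
    exact lintegral_gammaPDF_of_nonpos le_rfl
  · rw [ae_dirac_iff measurableSet_Ici]

/-- The weight turns exp(-y) in the density into exp(-cy): tilting is rescaling, up to a constant.
The factor is the same for every shape a, so tilting by a sum rescales all coordinates alike. -/
theorem lintegral_exp_mul_gammaLaw {a : ℝ} (ha : 0 ≤ a) {c : ℝ} (hc : 0 < c) {h : ℝ → ℝ≥0∞}
    (hh : Measurable h) :
    ∫⁻ y, h y * ENNReal.ofReal (Real.exp ((1 - c) * y)) ∂gammaLaw a =
      ENNReal.ofReal (c ^ (-a)) * ∫⁻ y, h (y / c) ∂gammaLaw a := by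
  rcases ha.eq_or_lt with rfl | ha
  · rw [gammaLaw_zero, lintegral_dirac' _ (by fun_prop), lintegral_dirac' _ (by fun_prop)]
    simp
  have mpdf : Measurable (gammaPDF a 1) := (measurable_gammaPDFReal a 1).ennreal_ofReal
  rw [gammaLaw, if_pos ha, gammaMeasure, lintegral_withDensity_eq_lintegral_mul _ mpdf (by fun_prop),
    lintegral_withDensity_eq_lintegral_mul _ mpdf (by fun_prop)]
  have hv : (volume : Measure ℝ) = ENNReal.ofReal c • Measure.map (c * ·) volume := by
    rw [Real.map_volume_mul_left hc.ne', smul_smul, ← ENNReal.ofReal_mul hc.le,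
      abs_of_pos (by positivity), mul_inv_cancel₀ hc.ne']
    simp
  conv_rhs => rw [hv]
  rw [lintegral_smul_measure, lintegral_map (by fun_prop) (by fun_prop), smul_eq_mul,
    ← mul_assoc, ← ENNReal.ofReal_mul (by positivity), ← lintegral_const_mul _ (by fun_prop)]
  refine lintegral_congr fun y => ?_
  simp only [Pi.mul_apply, mul_div_cancel_left₀ y hc.ne']
  rcases lt_or_ge y 0 with hy | hy
  · rw [gammaPDF_of_neg hy, gammaPDF_of_neg (mul_neg_of_pos_of_neg hc hy)]; simp
  have : gammaPDF a 1 y * ENNReal.ofReal (Real.exp ((1 - c) * y)) =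
      ENNReal.ofReal (c ^ (-a) * c) * gammaPDF a 1 (c * y) := by
    rw [gammaPDF_of_nonneg hy, gammaPDF_of_nonneg (by positivity),
      ← ENNReal.ofReal_mul (by positivity), ← ENNReal.ofReal_mul (by positivity)]
    congr 1
    rw [Real.mul_rpow hc.le hy, Real.rpow_neg hc.le, Real.rpow_sub_one hc.ne',
      show (1 - c) * y = -(1 * (c * y)) - -(1 * y) by ring, Real.exp_sub]
    field_simp
  rw [← mul_assoc (ENNReal.ofReal _), ← this]
  ring

theorem lintegral_exp_mul_pi_gammaLaw {ι : Type*} [Fintype ι] {ρ : ι → ℝ} (hρ : ∀ i, 0 ≤ ρ i)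
    {c : ℝ} (hc : 0 < c) {h : (ι → ℝ) → ℝ≥0∞} (hh : Measurable h) :
    ∫⁻ g, h g * ENNReal.ofReal (Real.exp ((1 - c) * ∑ i, g i))
        ∂(Measure.pi fun i => gammaLaw (ρ i)) =
      ENNReal.ofReal (c ^ (-∑ i, ρ i)) *
        ∫⁻ g, h (fun i => g i / c) ∂(Measure.pi fun i => gammaLaw (ρ i)) := by
  set P := Measure.pi fun i => gammaLaw (ρ i) with hP
  set C := ENNReal.ofReal (c ^ (-∑ i, ρ i)) with hC
  have hC0 : C ≠ 0 := by simp [hC, Real.rpow_pos_of_pos hc]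
  have hCt : C ≠ ∞ := ENNReal.ofReal_ne_top
  have hf : Measurable fun g : ι → ℝ => ENNReal.ofReal (Real.exp ((1 - c) * ∑ i, g i)) := by
    fun_prop
  have : ∀ i, IsProbabilityMeasure ((gammaLaw (ρ i)).map fun y => y / c) := fun i =>
    Measure.isProbabilityMeasure_map (by fun_prop)
  -- It suffices to compare the two measures on boxes, where the exponential of the sum factors over
  -- the coordinates.
  have key : P.map (fun g i => g i / c) =
      C⁻¹ • P.withDensity fun g => ENNReal.ofReal (Real.exp ((1 - c) * ∑ i, g i)) := by
    rw [hP, Measure.pi_map_pi (f := fun i (y : ℝ) => y / c) (by fun_prop)]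
    refine Measure.pi_eq fun s hs => ?_
    rw [Measure.smul_apply, withDensity_apply _ (MeasurableSet.univ_pi hs),
      ← lintegral_indicator (MeasurableSet.univ_pi hs)]
    have e1 : ∀ g : ι → ℝ, (Set.univ.pi s).indicator
        (fun g => ENNReal.ofReal (Real.exp ((1 - c) * ∑ i, g i))) g =
        ∏ i, (s i).indicator 1 (g i) * ENNReal.ofReal (Real.exp ((1 - c) * g i)) := by
      intro g
      rw [Finset.prod_mul_distrib, ← ENNReal.ofReal_prod_of_nonneg fun i _ => (Real.exp_pos _).le,
        ← Real.exp_sum, ← Finset.mul_sum]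
      by_cases hg : g ∈ Set.univ.pi s
      · rw [Set.indicator_of_mem hg, Finset.prod_eq_one, one_mul]
        exact fun i _ => Set.indicator_of_mem (hg i trivial) _
      · rw [Set.indicator_of_notMem hg]
        simp only [Set.mem_pi, Set.mem_univ, true_imp_iff, not_forall] at hg
        obtain ⟨i, hi⟩ := hg
        rw [Finset.prod_eq_zero (Finset.mem_univ i) (Set.indicator_of_notMem hi _), zero_mul]
    have m1 : ∀ i, Measurable ((s i).indicator (1 : ℝ → ℝ≥0∞)) := fun i =>
      measurable_one.indicator (hs i)
    rw [lintegral_congr e1, lintegral_prod_eq_prod_lintegral_of_indepFun Finset.univ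
      (fun i (g : ι → ℝ) => (s i).indicator 1 (g i) * ENNReal.ofReal (Real.exp ((1 - c) * g i)))
      (iIndepFun_pi (X := fun i (y : ℝ) =>
        (s i).indicator (1 : ℝ → ℝ≥0∞) y * ENNReal.ofReal (Real.exp ((1 - c) * y)))
        fun i => by have := m1 i; fun_prop) (fun i => by have := m1 i; fun_prop)]
    have e2 : ∀ i, ∫⁻ g : ι → ℝ, (s i).indicator 1 (g i) *
        ENNReal.ofReal (Real.exp ((1 - c) * g i)) ∂(Measure.pi fun i => gammaLaw (ρ i)) =
        ENNReal.ofReal (c ^ (-ρ i)) * (gammaLaw (ρ i)).map (fun y => y / c) (s i) := by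
      intro i
      have := m1 i
      rw [(measurePreserving_eval (fun i => gammaLaw (ρ i)) i).lintegral_comp
        (f := fun y => (s i).indicator 1 y * ENNReal.ofReal (Real.exp ((1 - c) * y)))
        (by fun_prop), lintegral_exp_mul_gammaLaw (hρ i) hc (m1 i),
        ← lintegral_map (f := (s i).indicator 1) (m1 i) (by fun_prop),
        lintegral_indicator_one (hs i)]
    rw [Finset.prod_congr rfl fun i _ => e2 i, Finset.prod_mul_distrib,
      ← ENNReal.ofReal_prod_of_nonneg fun i _ => Real.rpow_nonneg hc.le _,
      ← Real.rpow_sum_of_pos hc, Finset.sum_neg_distrib, ← hC, smul_eq_mul, ← mul_assoc,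
      ENNReal.inv_mul_cancel hC0 hCt, one_mul]
  have h1 : ∫⁻ g, h (fun i => g i / c) ∂P = ∫⁻ g, h g ∂(P.map fun g i => g i / c) := by
    rw [lintegral_map hh (by fun_prop)]
  rw [h1, key, lintegral_smul_measure, smul_eq_mul, ← mul_assoc, ENNReal.mul_inv_cancel hC0 hCt,
    one_mul, lintegral_withDensity_eq_lintegral_mul _ hf hh]
  refine lintegral_congr fun g => ?_
  simp [mul_comm]

/-- The law of independent Gamma variables with parameters `ρ` and `ρ₀`. -/
abbrev gammaProd {ι : Type*} [Fintype ι] (ρ : ι → ℝ) (ρ₀ : ℝ) : Measure ((ι → ℝ) × ℝ) :=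
  (Measure.pi fun i => gammaLaw (ρ i)).prod (gammaLaw ρ₀)

/-- The sum of all coordinates. -/
abbrev gammaTotal {ι : Type*} [Fintype ι] (g : (ι → ℝ) × ℝ) : ℝ := ∑ j, g.1 j + g.2

theorem dirichlet_eq_map {ι : Type*} [Fintype ι] (ρ : ι → ℝ) (ρ₀ : ℝ) :
    dirichlet ρ ρ₀ = (gammaProd ρ ρ₀).map fun g i => g.1 i / gammaTotal g := rfl

instance isProbabilityMeasure_dirichlet {ι : Type*} [Fintype ι] (ρ : ι → ℝ) (ρ₀ : ℝ) :
    IsProbabilityMeasure (dirichlet ρ ρ₀) :=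
  Measure.isProbabilityMeasure_map (by fun_prop)

theorem lintegral_exp_mul_gammaProd {ι : Type*} [Fintype ι] {ρ : ι → ℝ} {ρ₀ : ℝ}
    (hρ : ∀ i, 0 ≤ ρ i) (h0 : 0 ≤ ρ₀) {c : ℝ} (hc : 0 < c) {h : (ι → ℝ) × ℝ → ℝ≥0∞}
    (hh : Measurable h) :
    ∫⁻ g, h g * ENNReal.ofReal (Real.exp ((1 - c) * gammaTotal g)) ∂gammaProd ρ ρ₀ =
      ENNReal.ofReal (c ^ (-(∑ i, ρ i + ρ₀))) *
        ∫⁻ g, h (fun i => g.1 i / c, g.2 / c) ∂gammaProd ρ ρ₀ := by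
  rw [lintegral_prod _ (by fun_prop), lintegral_prod _ (by fun_prop)]
  have e1 : ∀ g : ι → ℝ, ∫⁻ y, h (g, y) *
      ENNReal.ofReal (Real.exp ((1 - c) * gammaTotal (g, y))) ∂gammaLaw ρ₀ =
      ENNReal.ofReal (c ^ (-ρ₀)) * (∫⁻ y, h (g, y / c) ∂gammaLaw ρ₀) *
        ENNReal.ofReal (Real.exp ((1 - c) * ∑ i, g i)) := by
    intro g
    rw [← lintegral_exp_mul_gammaLaw h0 hc (h := fun y => h (g, y)) (by fun_prop),
      ← lintegral_mul_const _ (by fun_prop)]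
    refine lintegral_congr fun y => ?_
    rw [mul_assoc, ← ENNReal.ofReal_mul (Real.exp_pos _).le, ← Real.exp_add]
    ring_nf
  have m1 : Measurable fun g : ι → ℝ => ∫⁻ y, h (g, y / c) ∂gammaLaw ρ₀ :=
    Measurable.lintegral_prod_right' (f := fun g : (ι → ℝ) × ℝ => h (g.1, g.2 / c)) (by fun_prop)
  rw [lintegral_congr e1, lintegral_exp_mul_pi_gammaLaw hρ hc (by fun_prop),
    lintegral_const_mul _ (by fun_prop), ← mul_assoc, ← ENNReal.ofReal_mul (by positivity),
    ← Real.rpow_add hc]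
  congr 3
  ring

/-- The total of independent Gamma variables is a Gamma variable which is independent of the
proportions. -/
theorem map_proportions_total_gammaProd {ι : Type*} [Fintype ι] {ρ : ι → ℝ} {ρ₀ : ℝ}
    (hρ : ∀ i, 0 ≤ ρ i) (h0 : 0 ≤ ρ₀) :
    (gammaProd ρ ρ₀).map (fun g => ((fun i => g.1 i / gammaTotal g), gammaTotal g)) =
      (dirichlet ρ ρ₀).prod (gammaLaw (∑ i, ρ i + ρ₀)) := by
  set σ := ∑ i, ρ i + ρ₀ with hσ
  have hσ0 : 0 ≤ σ := add_nonneg (Finset.sum_nonneg fun i _ => hρ i) h0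
  have hD : Measurable fun (g : (ι → ℝ) × ℝ) (i : ι) => g.1 i / gammaTotal g := by fun_prop
  have hS : Measurable fun g : (ι → ℝ) × ℝ => gammaTotal g := by fun_prop
  refine (Measure.prod_eq fun B C hB hC => ?_).symm
  rw [Measure.map_apply (by fun_prop) (hB.prod hC)]
  -- The law of the total on the event that the proportions lie in B. It is identified with a
  -- multiple of a Gamma law through its moment generating function.
  set μ := ((gammaProd ρ ρ₀).restrict ((fun g i => g.1 i / gammaTotal g) ⁻¹' B)).map
    fun g => gammaTotal g with hμ
  have key : μ = dirichlet ρ ρ₀ B • gammaLaw σ := by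
    have : IsFiniteMeasure (dirichlet ρ ρ₀ B • gammaLaw σ) :=
      Measure.smul_finite _ (measure_ne_top _ _)
    have gl : ∀ t ∈ Set.Ioo (-1 : ℝ) 1, ∫⁻ y, ENNReal.ofReal (Real.exp (t * y)) ∂gammaLaw σ =
        ENNReal.ofReal ((1 - t) ^ (-σ)) := by
      intro t ht
      have := lintegral_exp_mul_gammaLaw hσ0 (c := 1 - t) (by linarith [ht.2])
        (h := fun _ => 1) measurable_const
      simpa using this
    refine ext_of_lintegral_exp_eq one_pos (fun t ht => ?_) fun t ht => ?_
    · rw [lintegral_smul_measure, gl t ht]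
      exact ENNReal.mul_ne_top (measure_ne_top _ _) ENNReal.ofReal_ne_top
    · have ht1 : 0 < 1 - t := by linarith [ht.2]
      rw [lintegral_smul_measure, gl t ht, hμ, lintegral_map (by fun_prop) hS,
        ← lintegral_indicator (hD hB)]
      -- Tilting with c = 1 - t produces exp(t · total). The event about proportions is scale
      -- invariant, so it survives the rescaling and its probability factors out.
      have := lintegral_exp_mul_gammaProd hρ h0 ht1
        (h := ((fun (g : (ι → ℝ) × ℝ) i => g.1 i / gammaTotal g) ⁻¹' B).indicator 1)
        (measurable_one.indicator (hD hB))
      calc _ = _ := lintegral_congr fun g => ?_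
        _ = _ := this
        _ = _ := ?_
      · by_cases hg : g ∈ ((fun (g : (ι → ℝ) × ℝ) i => g.1 i / gammaTotal g) ⁻¹' B)
        · simp only [Set.indicator_of_mem hg]; simp
        · simp only [Set.indicator_of_notMem hg]; simp
      · rw [mul_comm, dirichlet_eq_map, Measure.map_apply hD hB, smul_eq_mul,
          ← lintegral_indicator_one (hD hB)]
        congr 1
        refine lintegral_congr fun g => ?_
        have : (fun i => g.1 i / (1 - t) / gammaTotal (fun i => g.1 i / (1 - t), g.2 / (1 - t))) =
            fun i => g.1 i / gammaTotal g := by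
          ext i
          simp only [gammaTotal]
          rw [← Finset.sum_div, ← add_div, div_div_div_cancel_right₀ ht1.ne']
        have hp : ∀ g : (ι → ℝ) × ℝ, ((fun (g : (ι → ℝ) × ℝ) i => g.1 i / gammaTotal g) ⁻¹'
            B).indicator (1 : (ι → ℝ) × ℝ → ℝ≥0∞) g = B.indicator 1 fun i => g.1 i / gammaTotal g :=
          fun g => rfl
        rw [hp, hp, this]
  have := congrArg (fun m => m C) key
  simp only [hμ, Measure.map_apply hS hC, Measure.restrict_apply (hS hC), Measure.smul_apply,
    smul_eq_mul] at this
  rw [← this]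
  congr 1
  ext g
  simp [and_comm]

theorem map_total_gammaProd {ι : Type*} [Fintype ι] {ρ : ι → ℝ} {ρ₀ : ℝ}
    (hρ : ∀ i, 0 ≤ ρ i) (h0 : 0 ≤ ρ₀) :
    (gammaProd ρ ρ₀).map (fun g => gammaTotal g) = gammaLaw (∑ i, ρ i + ρ₀) := by
  have h := congrArg Measure.snd (map_proportions_total_gammaProd hρ h0)
  rwa [Measure.snd_prod, Measure.snd, Measure.map_map measurable_snd (by fun_prop)] at h

/-! ### Splitting and marginals of Dirichlet laws -/

section Split

variable {ι : Type*} [Fintype ι]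

theorem pi_gammaLaw_ae_nonneg (ρ : ι → ℝ) :
    ∀ᵐ g ∂(Measure.pi fun i => gammaLaw (ρ i)), ∀ i, 0 ≤ g i :=
  ae_all_iff.2 fun i => (measurePreserving_eval (fun i => gammaLaw (ρ i)) i
    ).quasiMeasurePreserving.ae (gammaLaw_ae_nonneg (ρ i))

theorem gammaProd_ae_nonneg (ρ : ι → ℝ) (ρ₀ : ℝ) :
    ∀ᵐ g ∂gammaProd ρ ρ₀, (∀ i, 0 ≤ g.1 i) ∧ 0 ≤ g.2 := by
  filter_upwards [Measure.quasiMeasurePreserving_fst.ae (pi_gammaLaw_ae_nonneg ρ),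
    Measure.quasiMeasurePreserving_snd.ae (gammaLaw_ae_nonneg ρ₀)] with g h h' using ⟨h, h'⟩

theorem dirichlet_ae_mem_Icc (ρ : ι → ℝ) (ρ₀ : ℝ) :
    ∀ᵐ t ∂dirichlet ρ ρ₀, ∀ i, t i ∈ Set.Icc 0 1 := by
  rw [dirichlet_eq_map, ae_map_iff (by fun_prop)
    (by
      simp only [Set.ofPred_forall]
      exact .iInter fun i => measurableSet_Icc.preimage (measurable_pi_apply i))]
  filter_upwards [gammaProd_ae_nonneg ρ ρ₀] with g hg i
  have h2 : g.1 i ≤ ∑ j, g.1 j := Finset.single_le_sum (fun j _ => hg.1 j) (Finset.mem_univ i)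
  have h3 : 0 ≤ gammaTotal g := add_nonneg (Finset.sum_nonneg fun j _ => hg.1 j) hg.2
  exact ⟨div_nonneg (hg.1 i) h3, div_le_one_of_le₀ (by simp only [gammaTotal]; linarith [hg.2]) h3⟩

variable (p : ι → Prop) [DecidablePred p]

/-- Combine vectors indexed by the two parts of a partition. -/
def mergeVec (a : {i // p i} → ℝ) (b : {i // ¬ p i} → ℝ) (i : ι) : ℝ :=
  if h : p i then a ⟨i, h⟩ else b ⟨i, h⟩

omit [Fintype ι] in
theorem measurable_mergeVec :
    Measurable fun z : ({i // p i} → ℝ) × ({i // ¬ p i} → ℝ) => mergeVec p z.1 z.2 := by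
  refine measurable_pi_iff.2 fun i => ?_
  unfold mergeVec
  split_ifs <;> fun_prop

theorem sum_mergeVec (a : {i // p i} → ℝ) (b : {i // ¬ p i} → ℝ) :
    ∑ i, mergeVec p a b i = ∑ i, a i + ∑ i, b i := by
  rw [← Fintype.sum_subtype_add_sum_subtype p]
  congr 1
  · exact Finset.sum_congr rfl fun i _ => by simp [mergeVec, i.2]
  · exact Finset.sum_congr rfl fun i _ => by simp [mergeVec, i.2]

theorem lintegral_gammaProd_merge (ρ : ι → ℝ) (ρ₀ : ℝ) {F : (ι → ℝ) × ℝ → ℝ≥0∞}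
    (hF : Measurable F) :
    ∫⁻ g, F g ∂gammaProd ρ ρ₀ =
      ∫⁻ z, F (mergeVec p z.1 z.2.1, z.2.2) ∂(Measure.pi fun i : {i // p i} => gammaLaw (ρ i)).prod
        (gammaProd (fun i : {i // ¬ p i} => ρ i) ρ₀) := by
  have h1 : Measurable fun g : ι → ℝ => ∫⁻ y, F (g, y) ∂gammaLaw ρ₀ := hF.lintegral_prod_right'
  have hm : Measurable fun z : (({i // p i} → ℝ) × ({i // ¬ p i} → ℝ)) × ℝ =>
      F (mergeVec p z.1.1 z.1.2, z.2) := by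
    have := (measurable_mergeVec p).comp
      (measurable_fst : Measurable (Prod.fst : (({i // p i} → ℝ) × ({i // ¬ p i} → ℝ)) × ℝ → _))
    exact hF.comp (this.prodMk measurable_snd)
  have hm' : Measurable fun z : ({i // p i} → ℝ) × (({i // ¬ p i} → ℝ) × ℝ) =>
      F (mergeVec p z.1 z.2.1, z.2.2) :=
    hm.comp (f := fun z : ({i // p i} → ℝ) × (({i // ¬ p i} → ℝ) × ℝ) => ((z.1, z.2.1), z.2.2))
      (by fun_prop)
  rw [lintegral_prod _ hF.aemeasurable, lintegral_prod _ hm'.aemeasurable,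
    ← (measurePreserving_piEquivPiSubtypeProd (fun i => gammaLaw (ρ i)) p).symm.lintegral_comp h1,
    lintegral_prod _ (by fun_prop)]
  refine lintegral_congr fun a => ?_
  exact (lintegral_prod (fun b : ({i // ¬ p i} → ℝ) × ℝ => F (mergeVec p a b.1, b.2))
    (hm'.comp measurable_prodMk_left).aemeasurable).symm

/-- The case ρ₀ = 0, where the extra Gamma variable is the constant 0. -/
theorem map_proportions_total_pi_gammaLaw {ρ : ι → ℝ} (hρ : ∀ i, 0 ≤ ρ i) :
    (Measure.pi fun i => gammaLaw (ρ i)).map (fun g => ((fun i => g i / ∑ j, g j), ∑ j, g j)) =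
      (dirichlet ρ 0).prod (gammaLaw (∑ i, ρ i)) := by
  have h := map_proportions_total_gammaProd hρ le_rfl
  rw [add_zero] at h
  rw [← h, gammaProd, gammaLaw_zero, Measure.prod_dirac, Measure.map_map (by fun_prop) (by fun_prop)]
  simp [Function.comp_def, gammaTotal]

/-- With A and B the Gamma totals of the two blocks (the extra variable counted in B), r = A / (A +
B). Within each block the proportions are independent of the total, so r, d and d' are independent.
The exact law `m` of r plays no role later. -/
theorem exists_lintegral_dirichlet_split {ρ : ι → ℝ} {ρ₀ : ℝ} (hρ : ∀ i, 0 ≤ ρ i) (h0 : 0 ≤ ρ₀) :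
    ∃ m : Measure ℝ, IsProbabilityMeasure m ∧ ∀ F : (ι → ℝ) → ℝ≥0∞, Measurable F →
      ∫⁻ t, F t ∂dirichlet ρ ρ₀ =
        ∫⁻ r, ∫⁻ d, ∫⁻ d', F (mergeVec p (r • d) ((1 - r) • d'))
          ∂dirichlet (fun i : {i // ¬ p i} => ρ i) ρ₀ ∂dirichlet (fun i : {i // p i} => ρ i) 0 ∂m := by
  set ρ₁ : {i // p i} → ℝ := fun i => ρ i
  set ρ₂ : {i // ¬ p i} → ℝ := fun i => ρ i
  set γ₁ := gammaLaw (∑ i, ρ₁ i)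
  set γ₂ := gammaLaw (∑ i, ρ₂ i + ρ₀)
  refine ⟨(γ₁.prod γ₂).map fun s => s.1 / (s.1 + s.2),
    Measure.isProbabilityMeasure_map (by fun_prop), fun F hF => ?_⟩
  have e1 := map_proportions_total_pi_gammaLaw (ρ := ρ₁) fun i => hρ i
  have e2 := map_proportions_total_gammaProd (ρ := ρ₂) (fun i => hρ i) h0
  have hmer : Measurable fun z : ℝ × ({i // p i} → ℝ) × ({i // ¬ p i} → ℝ) =>
      F (mergeVec p (z.1 • z.2.1) ((1 - z.1) • z.2.2)) :=
    hF.comp ((measurable_mergeVec p).comp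
      (f := fun z : ℝ × ({i // p i} → ℝ) × ({i // ¬ p i} → ℝ) => (z.1 • z.2.1, (1 - z.1) • z.2.2))
      (by fun_prop))
  set H : (({i // p i} → ℝ) × ℝ) × (({i // ¬ p i} → ℝ) × ℝ) → ℝ≥0∞ := fun z =>
    F (mergeVec p ((z.1.2 / (z.1.2 + z.2.2)) • z.1.1) ((1 - z.1.2 / (z.1.2 + z.2.2)) • z.2.1))
  have hH : Measurable H := hmer.comp
    (f := fun z : (({i // p i} → ℝ) × ℝ) × (({i // ¬ p i} → ℝ) × ℝ) =>
      (z.1.2 / (z.1.2 + z.2.2), z.1.1, z.2.1)) (by fun_prop)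
  have step1 : ∫⁻ t, F t ∂dirichlet ρ ρ₀ =
      ∫⁻ z, H z ∂((dirichlet ρ₁ 0).prod γ₁).prod ((dirichlet ρ₂ ρ₀).prod γ₂) := by
    rw [← e1, ← e2, Measure.map_prod_map _ _ (by fun_prop) (by fun_prop),
      lintegral_map hH (by fun_prop), dirichlet_eq_map, lintegral_map hF (by fun_prop),
      lintegral_gammaProd_merge p ρ ρ₀ (F := fun g => F fun i => g.1 i / gammaTotal g)
        (by fun_prop)]
    have n1 : ∀ᵐ z ∂(Measure.pi fun i : {i // p i} => gammaLaw (ρ i)).prod (gammaProd ρ₂ ρ₀),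
        (∀ i, 0 ≤ z.1 i) ∧ (∀ i, 0 ≤ z.2.1 i) ∧ 0 ≤ z.2.2 := by
      filter_upwards [Measure.quasiMeasurePreserving_fst.ae (pi_gammaLaw_ae_nonneg ρ₁),
        Measure.quasiMeasurePreserving_snd.ae (gammaProd_ae_nonneg ρ₂ ρ₀)] with z h h'
        using ⟨h, h'⟩
    refine lintegral_congr_ae ?_
    filter_upwards [n1] with z hz
    obtain ⟨ha, hb, hy⟩ := hz
    simp only [H, Prod.map_fst, Prod.map_snd, gammaTotal]
    rw [sum_mergeVec, add_assoc]
    set A := ∑ i, z.1 i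
    set B := ∑ i, z.2.1 i + z.2.2
    have hA : 0 ≤ A := Finset.sum_nonneg fun i _ => ha i
    have hB' : 0 ≤ ∑ i, z.2.1 i := Finset.sum_nonneg fun i _ => hb i
    have hB : 0 ≤ B := add_nonneg hB' hy
    congr 1
    ext i
    simp only [mergeVec]
    split_ifs with h
    · have hle : z.1 ⟨i, h⟩ ≤ A := Finset.single_le_sum (fun j _ => ha j) (Finset.mem_univ _)
      simp only [Pi.smul_apply, smul_eq_mul]
      -- If a block total is 0, all its nonnegative coordinates vanish, and the identity holds with
      -- 0 / 0 = 0.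
      rcases hA.eq_or_lt with hA0 | hA0
      · have : z.1 ⟨i, h⟩ = 0 := le_antisymm (by rw [hA0]; exact hle) (ha _)
        simp [this]
      · field_simp
    · have hle : z.2.1 ⟨i, h⟩ ≤ B := (Finset.single_le_sum (fun j _ => hb j)
        (Finset.mem_univ _)).trans (le_add_of_nonneg_right hy)
      simp only [Pi.smul_apply, smul_eq_mul]
      rcases hB.eq_or_lt with hB0 | hB0
      · have : z.2.1 ⟨i, h⟩ = 0 := le_antisymm (by rw [hB0]; exact hle) (hb _)
        simp [this]
      · have : A + B ≠ 0 := by positivity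
        field_simp
        ring
  rw [step1, lintegral_prod _ (by fun_prop), lintegral_prod _ (by fun_prop)]
  have step2 : ∀ d s, ∫⁻ w, H ((d, s), w) ∂(dirichlet ρ₂ ρ₀).prod γ₂ =
      ∫⁻ s', ∫⁻ d', H ((d, s), (d', s')) ∂dirichlet ρ₂ ρ₀ ∂γ₂ := fun d s =>
    lintegral_prod_symm _ (by fun_prop)
  simp only [step2]
  have hmer2 : Measurable fun z : ℝ × ({i // p i} → ℝ) => ∫⁻ d',
      F (mergeVec p (z.1 • z.2) ((1 - z.1) • d')) ∂dirichlet ρ₂ ρ₀ :=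
    Measurable.lintegral_prod_right' (f := fun z : (ℝ × ({i // p i} → ℝ)) × ({i // ¬ p i} → ℝ) =>
      F (mergeVec p (z.1.1 • z.1.2) ((1 - z.1.1) • z.2)))
      (hmer.comp (f := fun z : (ℝ × ({i // p i} → ℝ)) × ({i // ¬ p i} → ℝ) => (z.1.1, z.1.2, z.2))
        (by fun_prop))
  have hmer3 : Measurable fun r : ℝ => ∫⁻ d, ∫⁻ d',
      F (mergeVec p (r • d) ((1 - r) • d')) ∂dirichlet ρ₂ ρ₀ ∂dirichlet ρ₁ 0 :=
    hmer2.lintegral_prod_right'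
  rw [lintegral_map hmer3 (by fun_prop)]
  rw [lintegral_lintegral_swap (μ := γ₁.prod γ₂)
    (f := fun s d => ∫⁻ d', F (mergeVec p ((s.1 / (s.1 + s.2)) • d)
      ((1 - s.1 / (s.1 + s.2)) • d')) ∂dirichlet ρ₂ ρ₀)
    (hmer2.comp (f := fun z : (ℝ × ℝ) × ({i // p i} → ℝ) => (z.1.1 / (z.1.1 + z.1.2), z.2))
      (by fun_prop)).aemeasurable]
  refine lintegral_congr fun d => ?_
  exact (lintegral_prod (fun s : ℝ × ℝ => ∫⁻ d', F (mergeVec p ((s.1 / (s.1 + s.2)) • d)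
      ((1 - s.1 / (s.1 + s.2)) • d')) ∂dirichlet ρ₂ ρ₀)
    (hmer2.comp (f := fun s : ℝ × ℝ => (s.1 / (s.1 + s.2), d)) (by fun_prop)).aemeasurable).symm

/-- The discarded Gamma variables enter only through their sum with the extra one, which is again
Gamma with the parameters added. -/
theorem map_restrict_dirichlet {ρ : ι → ℝ} {ρ₀ : ℝ} (hρ : ∀ i, 0 ≤ ρ i) (h0 : 0 ≤ ρ₀) :
    (dirichlet ρ ρ₀).map (fun t (i : {i // p i}) => t i) =
      dirichlet (fun i : {i // p i} => ρ i) (∑ i : {i // ¬ p i}, ρ i + ρ₀) := by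
  refine Measure.ext_of_lintegral _ fun F hF => ?_
  rw [lintegral_map hF (by fun_prop), dirichlet_eq_map, lintegral_map (by fun_prop) (by fun_prop),
    lintegral_gammaProd_merge p ρ ρ₀
      (F := fun g => F fun i : {i // p i} => g.1 i / gammaTotal g) (by fun_prop),
    dirichlet_eq_map, lintegral_map hF (by fun_prop)]
  rw [gammaProd.eq_1 (fun i : {i // p i} => ρ i),
    ← map_total_gammaProd (ρ := fun i : {i // ¬ p i} => ρ i) (fun i => hρ i) h0]
  conv_rhs => rw [← Measure.map_id (μ := Measure.pi fun i : {i // p i} => gammaLaw (ρ i))]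
  rw [Measure.map_prod_map _ _ (by fun_prop) (by fun_prop), lintegral_map (by fun_prop) (by fun_prop)]
  refine lintegral_congr fun z => ?_
  simp only [gammaTotal, sum_mergeVec, Prod.map_fst, Prod.map_snd, id]
  congr 1
  ext i
  simp [mergeVec, i.2, add_assoc]

theorem map_comp_equiv_dirichlet {κ : Type*} [Fintype κ] (e : κ ≃ ι) (ρ : ι → ℝ) (ρ₀ : ℝ) :
    (dirichlet ρ ρ₀).map (fun t => t ∘ e) = dirichlet (ρ ∘ e) ρ₀ := by
  have h : (Measure.pi fun i => gammaLaw (ρ i)).map (fun t => t ∘ e) =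
      Measure.pi fun k => gammaLaw (ρ (e k)) := by
    have := (measurePreserving_piCongrLeft (fun k => gammaLaw (ρ (e k))) e.symm).map_eq
    simp only [Equiv.apply_symm_apply] at this
    rw [← this]
    congr 1
    ext t k
    obtain ⟨i, rfl⟩ := e.symm.surjective k
    simp [MeasurableEquiv.coe_piCongrLeft]
  rw [dirichlet_eq_map, dirichlet_eq_map, gammaProd, gammaProd]
  simp only [Function.comp_apply]
  rw [← h]
  conv_rhs => rw [← Measure.map_id (μ := gammaLaw ρ₀)]
  rw [Measure.map_prod_map _ _ (by fun_prop) (by fun_prop), Measure.map_map (by fun_prop) (by fun_prop),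
    Measure.map_map (by fun_prop) (by fun_prop)]
  congr 1
  ext g k
  simp [gammaTotal, Equiv.sum_comp e]

/-- Serves for one coordinate, giving the Beta law of T_e, and for two, giving the law in `Psi`. -/
theorem map_comp_injective_dirichlet {κ : Type*} [Fintype κ] {j : κ → ι} (hj : j.Injective)
    {ρ : ι → ℝ} {ρ₀ : ℝ} (hρ : ∀ i, 0 ≤ ρ i) (h0 : 0 ≤ ρ₀) :
    (dirichlet ρ ρ₀).map (fun t => t ∘ j) =
      dirichlet (ρ ∘ j) (∑ i, ρ i - ∑ k, ρ (j k) + ρ₀) := by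
  classical
  let e : κ ≃ {i // ∃ k, j k = i} := Equiv.ofInjective j hj
  have h1 := map_restrict_dirichlet (fun i => ∃ k, j k = i) hρ h0
  have h2 := congrArg (Measure.map fun t => t ∘ e) h1
  rw [Measure.map_map (by fun_prop) (by fun_prop), map_comp_equiv_dirichlet] at h2
  have h3 : ∑ i : {i // ¬ ∃ k, j k = i}, ρ i = ∑ i, ρ i - ∑ k, ρ (j k) := by
    rw [← Fintype.sum_subtype_add_sum_subtype (fun i => ∃ k, j k = i) ρ,
      ← e.sum_comp (fun i => ρ i)]
    have he : ∀ k, (e k : ι) = j k := fun k => rfl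
    simp only [he]
    ring
  rw [h3] at h2
  exact h2

end Split

/-! ### Negative association -/

/-- The rearrangement inequality without subtraction: for b = a + x and d = c + y the right side has
the additional term x * y. -/
theorem ENNReal.mul_add_mul_le_of_le_of_le {a b c d : ℝ≥0∞} (hab : a ≤ b) (hcd : c ≤ d) :
    a * d + b * c ≤ a * c + b * d := by
  obtain ⟨x, rfl⟩ := exists_add_of_le hab
  obtain ⟨y, rfl⟩ := exists_add_of_le hcd
  calc a * (c + y) + (a + x) * c = a * c + (a * c + a * y + x * c) := by ring
    _ ≤ a * c + (a * c + a * y + x * c + x * y) := add_le_add le_rfl le_self_add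
    _ = _ := by ring

/-- Chebyshev's inequality for oppositely ordered functions. -/
theorem lintegral_mul_le_of_monotone_antitone {α : Type*} [LinearOrder α] [MeasurableSpace α]
    {m : Measure α} [IsProbabilityMeasure m] {φ ψ : α → ℝ≥0∞} (hφm : Measurable φ)
    (hψm : Measurable ψ) (hφ : Monotone φ) (hψ : Antitone ψ) :
    ∫⁻ r, φ r * ψ r ∂m ≤ (∫⁻ r, φ r ∂m) * ∫⁻ r, ψ r ∂m := by
  have key : ∀ r r', φ r * ψ r + φ r' * ψ r' ≤ φ r * ψ r' + φ r' * ψ r := by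
    intro r r'
    rcases le_total r r' with h | h
    · have := ENNReal.mul_add_mul_le_of_le_of_le (hφ h) (hψ h)
      simpa [add_comm] using this
    · have := ENNReal.mul_add_mul_le_of_le_of_le (hφ h) (hψ h)
      simpa [add_comm] using this
  -- Integrated over two independent copies, the sides become twice the two sides of the claim. Only
  -- the factor 2 is cancelled, so infinite integrals are harmless.
  have h2 : ∫⁻ r, ∫⁻ r', (φ r * ψ r + φ r' * ψ r') ∂m ∂m ≤
      ∫⁻ r, ∫⁻ r', (φ r * ψ r' + φ r' * ψ r) ∂m ∂m :=
    lintegral_mono fun r => lintegral_mono fun r' => key r r'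
  have e1 : ∀ r, ∫⁻ r', (φ r * ψ r + φ r' * ψ r') ∂m = φ r * ψ r + ∫⁻ r', φ r' * ψ r' ∂m := by
    intro r
    rw [lintegral_add_left measurable_const]
    simp
  have e2 : ∀ r, ∫⁻ r', (φ r * ψ r' + φ r' * ψ r) ∂m =
      φ r * (∫⁻ r', ψ r' ∂m) + (∫⁻ r', φ r' ∂m) * ψ r := by
    intro r
    rw [lintegral_add_left (by fun_prop), lintegral_const_mul _ hψm, lintegral_mul_const _ hφm]
  simp only [e1, e2] at h2
  rw [lintegral_add_right _ measurable_const, lintegral_add_left (by fun_prop),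
    lintegral_mul_const _ hφm, lintegral_const_mul _ hψm, lintegral_const, measure_univ, mul_one,
    ← two_mul, ← two_mul] at h2
  exact (ENNReal.mul_le_mul_iff_right two_ne_zero ENNReal.ofNat_ne_top).1 h2

/-- Both functions are increasing or both are decreasing. -/
def Comonotone {α β γ : Type*} [Preorder α] [Preorder β] [Preorder γ] (f : α → β) (g : α → γ) :
    Prop :=
  Monotone f ∧ Monotone g ∨ Antitone f ∧ Antitone g

/-- A law of vectors is negatively associated if comonotone nonnegative functions of disjoint
sets of coordinates are negatively correlated. -/
def NegAssocLaw {κ : Type*} (μ : Measure (κ → ℝ)) : Prop :=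
  ∀ s t : Set κ, Disjoint s t → ∀ f g : (κ → ℝ) → ℝ≥0∞, Measurable f → Measurable g →
    DependsOn f s → DependsOn g t → Comonotone f g →
    ∫⁻ y, f y * g y ∂μ ≤ (∫⁻ y, f y ∂μ) * ∫⁻ y, g y ∂μ

/-- Split the vector at s. Given r the blocks are independent, so the mean of f g is that of φ(r)
ψ(r). Raising r enlarges the coordinates in s and shrinks the others, so φ and ψ are oppositely
ordered and Chebyshev's inequality applies. -/
theorem negAssocLaw_dirichlet {ι : Type*} [Fintype ι] {ρ : ι → ℝ} {ρ₀ : ℝ} (hρ : ∀ i, 0 ≤ ρ i)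
    (h0 : 0 ≤ ρ₀) : NegAssocLaw (dirichlet ρ ρ₀) := by
  classical
  intro s t hst f g hf hg hfs hgt hfg
  obtain ⟨m, hm, split⟩ := exists_lintegral_dirichlet_split (· ∈ s) hρ h0
  set δ := dirichlet (fun i : {i // i ∈ s} => ρ i) 0
  set δ' := dirichlet (fun i : {i // ¬ i ∈ s} => ρ i) ρ₀
  have mer1 : Measurable fun a : {i // i ∈ s} → ℝ => mergeVec (· ∈ s) a 0 :=
    (measurable_mergeVec (· ∈ s)).comp (measurable_prodMk_right (y := (0 : {i // ¬ i ∈ s} → ℝ)))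
  have mer2 : Measurable fun b : {i // ¬ i ∈ s} → ℝ => mergeVec (· ∈ s) 0 b :=
    (measurable_mergeVec (· ∈ s)).comp (measurable_prodMk_left (x := (0 : {i // i ∈ s} → ℝ)))
  have hf' : ∀ a b, f (mergeVec (· ∈ s) a b) = f (mergeVec (· ∈ s) a 0) := fun a b =>
    hfs fun i hi => by simp [mergeVec, hi]
  have hg' : ∀ a b, g (mergeVec (· ∈ s) a b) = g (mergeVec (· ∈ s) 0 b) := fun a b =>
    hgt fun i hi => by
      have : i ∉ s := fun h => Set.disjoint_left.1 hst h hi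
      simp [mergeVec, this]
  set φ : ℝ → ℝ≥0∞ := fun r => ∫⁻ d, f (mergeVec (· ∈ s) (r • d) 0) ∂δ
  set ψ : ℝ → ℝ≥0∞ := fun r => ∫⁻ d, g (mergeVec (· ∈ s) 0 ((1 - r) • d)) ∂δ'
  have mf : Measurable fun z : ℝ × ({i // i ∈ s} → ℝ) => f (mergeVec (· ∈ s) (z.1 • z.2) 0) :=
    hf.comp (mer1.comp (by fun_prop))
  have mg : Measurable fun z : ℝ × ({i // ¬ i ∈ s} → ℝ) =>
      g (mergeVec (· ∈ s) 0 ((1 - z.1) • z.2)) :=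
    hg.comp (mer2.comp (by fun_prop))
  have mφ : Measurable φ := mf.lintegral_prod_right'
  have mψ : Measurable ψ := mg.lintegral_prod_right'
  have E1 : ∫⁻ y, f y ∂dirichlet ρ ρ₀ = ∫⁻ r, φ r ∂m := by
    rw [split f hf]
    simp only [hf', lintegral_const, measure_univ, mul_one]
    rfl
  have E2 : ∫⁻ y, g y ∂dirichlet ρ ρ₀ = ∫⁻ r, ψ r ∂m := by
    rw [split g hg]
    simp only [hg', lintegral_const, measure_univ, mul_one]
    rfl
  have E3 : ∫⁻ y, f y * g y ∂dirichlet ρ ρ₀ = ∫⁻ r, φ r * ψ r ∂m := by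
    rw [split (fun y => f y * g y) (hf.mul hg)]
    refine lintegral_congr fun r => ?_
    have : ∀ d : {i // i ∈ s} → ℝ, ∫⁻ d', f (mergeVec (· ∈ s) (r • d) ((1 - r) • d')) *
        g (mergeVec (· ∈ s) (r • d) ((1 - r) • d')) ∂δ' =
        f (mergeVec (· ∈ s) (r • d) 0) * ψ r := by
      intro d
      simp only [hf' (r • d), hg' (r • d)]
      exact lintegral_const_mul _ (mg.comp (f := fun d' => (r, d')) (by fun_prop))
    simp only [this]
    exact lintegral_mul_const _ (mf.comp (f := fun d => (r, d)) (by fun_prop))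
  have hd := dirichlet_ae_mem_Icc (fun i : {i // i ∈ s} => ρ i) 0
  have hd' := dirichlet_ae_mem_Icc (fun i : {i // ¬ i ∈ s} => ρ i) ρ₀
  have le1 : ∀ {r r' : ℝ} {d : {i // i ∈ s} → ℝ}, r ≤ r' → (∀ i, d i ∈ Set.Icc (0 : ℝ) 1) →
      mergeVec (· ∈ s) (r • d) 0 ≤ mergeVec (· ∈ s) (r' • d) 0 := by
    intro r r' d h hd i
    by_cases hi : i ∈ s
    · simpa [mergeVec, hi] using mul_le_mul_of_nonneg_right h (hd ⟨i, hi⟩).1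
    · simp [mergeVec, hi]
  have le2 : ∀ {r r' : ℝ} {d : {i // ¬ i ∈ s} → ℝ}, r ≤ r' → (∀ i, d i ∈ Set.Icc (0 : ℝ) 1) →
      mergeVec (· ∈ s) 0 ((1 - r') • d) ≤ mergeVec (· ∈ s) 0 ((1 - r) • d) := by
    intro r r' d h hd i
    by_cases hi : i ∈ s
    · simp [mergeVec, hi]
    · simpa [mergeVec, hi] using mul_le_mul_of_nonneg_right (sub_le_sub_left h 1) (hd ⟨i, hi⟩).1
  rw [E1, E2, E3]
  rcases hfg with ⟨hf1, hg1⟩ | ⟨hf1, hg1⟩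
  · refine lintegral_mul_le_of_monotone_antitone mφ mψ (fun r r' h => ?_) fun r r' h => ?_
    · exact lintegral_mono_ae (hd.mono fun d hd => hf1 (le1 h hd))
    · exact lintegral_mono_ae (hd'.mono fun d hd => hg1 (le2 h hd))
  -- For decreasing f and g the roles swap: ψ increases with r and φ decreases.
  · simp only [mul_comm (φ _)]
    rw [mul_comm]
    refine lintegral_mul_le_of_monotone_antitone mψ mφ (fun r r' h => ?_) fun r r' h => ?_
    · exact lintegral_mono_ae (hd'.mono fun d hd => hg1 (le2 h hd))
    · exact lintegral_mono_ae (hd.mono fun d hd => hf1 (le1 h hd))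

/-! ### Negative association over independent left-nodes -/

section Product

variable {U : Type*} [DecidableEq U]

/-- Each node matters to at most one factor, so at each integration the other factor is a constant.
The exact marginals of X_e need this equality. -/
theorem lmarginal_mul_eq_of_disjoint {X : U → Type*} [∀ u, MeasurableSpace (X u)]
    {μ : ∀ u, Measure (X u)} [∀ u, IsProbabilityMeasure (μ u)] {a b : Set U} (hab : Disjoint a b)
    {f g : (∀ u, X u) → ℝ≥0∞} (hf : Measurable f) (hg : Measurable g) (hfa : DependsOn f a)
    (hgb : DependsOn g b) (F : Finset U) (ω : ∀ u, X u) :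
    lmarginal μ F (fun ω => f ω * g ω) ω = lmarginal μ F f ω * lmarginal μ F g ω := by
  have dep : ∀ {h : (∀ u, X u) → ℝ≥0∞} {c : Set U}, DependsOn h c → ∀ F, DependsOn
      (lmarginal μ F h) c := by
    intro h c hc F ω ω' hω
    refine lintegral_congr fun y => hc fun u hu => ?_
    simp only [Function.updateFinset]
    split_ifs
    · rfl
    · exact hω u hu
  induction F using Finset.induction generalizing ω with
  | empty => simp
  | insert u F hu ih =>
    rw [lmarginal_insert (fun ω => f ω * g ω) (hf.mul hg) hu, lmarginal_insert _ hf hu, lmarginal_insert _ hg hu]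
    simp only [ih]
    have hmf : Measurable fun y => lmarginal μ F f (Function.update ω u y) :=
      (hf.lmarginal μ).comp (measurable_update ω)
    have hmg : Measurable fun y => lmarginal μ F g (Function.update ω u y) :=
      (hg.lmarginal μ).comp (measurable_update ω)
    have upd : ∀ {h : (∀ u, X u) → ℝ≥0∞} {c : Set U}, DependsOn h c → u ∉ c → ∀ y,
        lmarginal μ F h (Function.update ω u y) = lmarginal μ F h ω := fun hc huc y =>
      dep hc F fun v hv => Function.update_of_ne (ne_of_mem_of_not_mem hv huc) _ _
    by_cases hua : u ∈ a
    · have hub : u ∉ b := fun h => Set.disjoint_left.1 hab hua h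
      simp only [upd hgb hub]
      rw [lintegral_mul_const _ hmf, lintegral_const, measure_univ, mul_one]
    · simp only [upd hfa hua]
      rw [lintegral_const_mul _ hmg, lintegral_const, measure_univ, mul_one]

variable {κ : U → Type*}

/-- A function of families of vectors depends only on the coordinates in `s`. -/
def DependsOnCoords {β : Type*} (f : (∀ u, κ u → ℝ) → β) (s : Set (Σ u, κ u)) : Prop :=
  ∀ ⦃ω ω'⦄, (∀ p ∈ s, ω p.1 p.2 = ω' p.1 p.2) → f ω = f ω'

variable {μ : ∀ u, Measure (κ u → ℝ)}

theorem DependsOnCoords.lmarginal {f : (∀ u, κ u → ℝ) → ℝ≥0∞} {s : Set (Σ u, κ u)}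
    (hf : DependsOnCoords f s) (F : Finset U) : DependsOnCoords (lmarginal μ F f) s := by
  intro ω ω' h
  refine lintegral_congr fun y => hf fun p hp => ?_
  simp only [Function.updateFinset]
  split_ifs
  · rfl
  · exact h p hp

theorem Monotone.lmarginal {f : (∀ u, κ u → ℝ) → ℝ≥0∞} (hf : Monotone f) (F : Finset U) :
    Monotone (lmarginal μ F f) := by
  intro ω ω' h
  refine lintegral_mono fun y => hf fun u => ?_
  simp only [Function.updateFinset]
  split_ifs
  · exact le_rfl
  · exact h u

theorem Antitone.lmarginal {f : (∀ u, κ u → ℝ) → ℝ≥0∞} (hf : Antitone f) (F : Finset U) :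
    Antitone (lmarginal μ F f) := by
  intro ω ω' h
  refine lintegral_mono fun y => hf fun u => ?_
  simp only [Function.updateFinset]
  split_ifs
  · exact le_rfl
  · exact h u

variable [∀ u, IsProbabilityMeasure (μ u)]

/-- Induction on the nodes integrated out: partial integrals keep the direction of monotonicity and
the relevant coordinates, so the hypothesis at the next node applies to them. Integrating only over
F leaves room for conditioning on the other nodes. -/
theorem lmarginal_mul_le (hμ : ∀ u, NegAssocLaw (μ u)) {s t : Set (Σ u, κ u)} (hst : Disjoint s t)
    {f g : (∀ u, κ u → ℝ) → ℝ≥0∞} (hf : Measurable f) (hg : Measurable g)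
    (hfs : DependsOnCoords f s) (hgt : DependsOnCoords g t) (hfg : Comonotone f g)
    (F : Finset U) (ω : ∀ u, κ u → ℝ) :
    lmarginal μ F (fun ω => f ω * g ω) ω ≤ lmarginal μ F f ω * lmarginal μ F g ω := by
  induction F using Finset.induction generalizing ω with
  | empty => simp
  | insert u F hu ih =>
    rw [lmarginal_insert (fun ω => f ω * g ω) (hf.mul hg) hu, lmarginal_insert _ hf hu, lmarginal_insert _ hg hu]
    refine (lintegral_mono fun y => ih _).trans ?_
    refine hμ u {k | ⟨u, k⟩ ∈ s} {k | ⟨u, k⟩ ∈ t}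
      (Set.disjoint_left.2 fun k hk hk' => Set.disjoint_left.1 hst hk hk') _ _
      ((hf.lmarginal μ).comp (measurable_update ω)) ((hg.lmarginal μ).comp (measurable_update ω))
      (fun y y' h => ?_) (fun y y' h => ?_) ?_
    · refine hfs.lmarginal F fun p hp => ?_
      obtain ⟨v, k⟩ := p
      by_cases hv : v = u
      · subst hv; simpa using h k hp
      · simp [hv]
    · refine hgt.lmarginal F fun p hp => ?_
      obtain ⟨v, k⟩ := p
      by_cases hv : v = u
      · subst hv; simpa using h k hp
      · simp [hv]
    · have hup : Monotone fun y => Function.update ω u y := by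
        intro y y' h v
        by_cases hv : v = u
        · subst hv; simpa using h
        · simp [hv]
      rcases hfg with ⟨h1, h2⟩ | ⟨h1, h2⟩
      · exact .inl ⟨(h1.lmarginal F).comp hup, (h2.lmarginal F).comp hup⟩
      · exact .inr ⟨(h1.lmarginal F).comp_monotone hup, (h2.lmarginal F).comp_monotone hup⟩

/-- Products of nonnegative functions monotone in one direction are again monotone in that
direction, so the two-factor inequality iterates. -/
theorem lmarginal_prod_le (hμ : ∀ u, NegAssocLaw (μ u)) {I : Type*} (T : Finset I)
    {s : I → Set (Σ u, κ u)} (hs : (T : Set I).PairwiseDisjoint s)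
    {h : I → (∀ u, κ u → ℝ) → ℝ≥0∞} (hm : ∀ i, Measurable (h i))
    (hd : ∀ i, DependsOnCoords (h i) (s i))
    (hmon : (∀ i, Monotone (h i)) ∨ (∀ i, Antitone (h i))) (F : Finset U) (ω : ∀ u, κ u → ℝ) :
    lmarginal μ F (fun ω => ∏ i ∈ T, h i ω) ω ≤ ∏ i ∈ T, lmarginal μ F (h i) ω := by
  classical
  induction T using Finset.induction with
  | empty => simp [lmarginal]
  | insert i T hi ih =>
    simp only [Finset.prod_insert hi]
    have hdis : Disjoint (s i) (⋃ j ∈ T, s j) := by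
      refine Set.disjoint_iUnion₂_right.2 fun j hj => hs (by simp) (by simp [hj]) ?_
      rintro rfl; exact hi hj
    refine (lmarginal_mul_le hμ hdis (hm i) (Finset.measurable_prod _ fun j _ => hm j) (hd i)
      (fun ω ω' hω => Finset.prod_congr rfl fun j hj => hd j fun p hp =>
        hω p (Set.mem_biUnion hj hp)) ?_ F ω).trans ?_
    · rcases hmon with hmon | hmon
      · exact .inl ⟨hmon i, fun ω ω' hω => Finset.prod_le_prod' fun j _ => hmon j hω⟩
      · exact .inr ⟨hmon i, fun ω ω' hω => Finset.prod_le_prod' fun j _ => hmon j hω⟩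
    · gcongr
      exact ih (hs.subset (by simp))

theorem lmarginal_prod_eq {I : Type*} (T : Finset I)
    {a : I → U} (ha : Set.InjOn a T)
    {h : I → (∀ u, κ u → ℝ) → ℝ≥0∞} (hm : ∀ i, Measurable (h i))
    (hd : ∀ i, DependsOn (h i) {a i}) (F : Finset U) (ω : ∀ u, κ u → ℝ) :
    lmarginal μ F (fun ω => ∏ i ∈ T, h i ω) ω = ∏ i ∈ T, lmarginal μ F (h i) ω := by
  classical
  induction T using Finset.induction with
  | empty => simp [lmarginal]
  | insert i T hi ih =>
    simp only [Finset.prod_insert hi]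
    have hdis : Disjoint {a i} (a '' T) := by
      rw [Set.disjoint_singleton_left]
      rintro ⟨j, hj, hji⟩
      have : j = i := ha (by simp [Finset.mem_coe.1 hj]) (by simp) hji
      exact hi (this ▸ hj)
    rw [lmarginal_mul_eq_of_disjoint hdis (hm i) (Finset.measurable_prod _ fun j _ => hm j) (hd i)
      (fun ω ω' hω => Finset.prod_congr rfl fun j hj => hd j fun u hu => hω u ?_),
      ih (ha.mono (by simp))]
    rw [Set.mem_singleton_iff.1 hu]
    exact ⟨j, hj, rfl⟩

end Product

/-! ### From nonnegative functions to covariances of real functions -/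

section Covariance

variable {Ω : Type*} [MeasurableSpace Ω] {μ : Measure Ω} [IsProbabilityMeasure μ]

/-- Truncation at the levels `-n` and `n`. -/
def clampReal (n : ℕ) (y : ℝ) : ℝ := max (-n) (min n y)

theorem monotone_clampReal (n : ℕ) : Monotone (clampReal n) := fun _ _ h =>
  max_le_max le_rfl (min_le_min le_rfl h)

theorem measurable_clampReal (n : ℕ) : Measurable (clampReal n) :=
  (monotone_clampReal n).measurable

theorem abs_clampReal_le (n : ℕ) (y : ℝ) : |clampReal n y| ≤ |y| := by
  have hn : (0 : ℝ) ≤ n := n.cast_nonneg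
  rw [abs_le]
  unfold clampReal
  constructor
  · rw [le_max_iff]
    by_cases h : -|y| ≤ -n
    · exact .inl h
    · right
      push Not at h
      exact le_min (by linarith [abs_nonneg y]) (neg_abs_le y)
  · refine max_le (by linarith [abs_nonneg y]) ((min_le_right _ _).trans (le_abs_self y))

theorem neg_le_clampReal (n : ℕ) (y : ℝ) : -(n : ℝ) ≤ clampReal n y := le_max_left _ _

theorem tendsto_clampReal (y : ℝ) :
    Filter.Tendsto (fun n => clampReal n y) Filter.atTop (nhds y) := by
  refine tendsto_const_nhds.congr' ?_
  obtain ⟨N, hN⟩ := exists_nat_ge |y|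
  filter_upwards [Filter.eventually_ge_atTop N] with n hn
  have h : |y| ≤ n := hN.trans (by exact_mod_cast hn)
  rw [abs_le] at h
  unfold clampReal
  rw [min_eq_right h.2, max_eq_right h.1]

theorem integral_sub_mul_sub {f g : Ω → ℝ} (hf : Integrable f μ)
    (hg : Integrable g μ) (hfg : Integrable (fun ω => f ω * g ω) μ) (a b : ℝ) :
    Integrable (fun ω => (f ω - a) * (g ω - b)) μ ∧ ∫ ω, (f ω - a) * (g ω - b) ∂μ =
      ∫ ω, f ω * g ω ∂μ - b * ∫ ω, f ω ∂μ - a * ∫ ω, g ω ∂μ + a * b := by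
  have e : ∀ ω, (f ω - a) * (g ω - b) = f ω * g ω - b * f ω - a * g ω + a * b := fun ω => by ring
  have i1 : Integrable (fun ω => f ω * g ω - b * f ω) μ := hfg.sub (hf.const_mul _)
  have i2 : Integrable (fun ω => f ω * g ω - b * f ω - a * g ω) μ := i1.sub (hg.const_mul _)
  simp only [e]
  refine ⟨i2.add (integrable_const _), ?_⟩
  rw [integral_add i2 (integrable_const _), integral_sub i1 (hg.const_mul _),
    integral_sub hfg (hf.const_mul _), integral_const_mul, integral_const_mul]
  simp

/-- Truncation at ±n followed by a shift by n yields nonnegative functions and preserves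
monotonicity. The shift does not change the covariance, and dominated convergence removes the
truncation. -/
theorem covariance_nonpos_of_lintegral_clampReal {f g : Ω → ℝ} (hf : Integrable f μ)
    (hg : Integrable g μ) (hfg : Integrable (fun ω => f ω * g ω) μ)
    (h : ∀ n : ℕ, ∫⁻ ω, ENNReal.ofReal (clampReal n (f ω) + n) *
        ENNReal.ofReal (clampReal n (g ω) + n) ∂μ ≤
      (∫⁻ ω, ENNReal.ofReal (clampReal n (f ω) + n) ∂μ) *
        ∫⁻ ω, ENNReal.ofReal (clampReal n (g ω) + n) ∂μ) :
    covariance f g μ ≤ 0 := by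
  have mc : ∀ {φ : Ω → ℝ}, Integrable φ μ → ∀ n, AEStronglyMeasurable (fun ω => clampReal n (φ ω)) μ :=
    fun hφ n => ((measurable_clampReal n).comp_aemeasurable hφ.aemeasurable).aestronglyMeasurable
  have ic : ∀ {φ : Ω → ℝ}, Integrable φ μ → ∀ n, Integrable (fun ω => clampReal n (φ ω)) μ :=
    fun hφ n => hφ.mono (mc hφ n) (.of_forall fun ω => abs_clampReal_le n _)
  have ifg : ∀ n, Integrable (fun ω => clampReal n (f ω) * clampReal n (g ω)) μ := fun n =>
    hfg.mono ((mc hf n).mul (mc hg n)) (.of_forall fun ω => by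
      simp only [Real.norm_eq_abs, abs_mul]
      exact mul_le_mul (abs_clampReal_le n _) (abs_clampReal_le n _) (abs_nonneg _) (abs_nonneg _))
  have lim : ∀ {φ : Ω → ℝ}, Integrable φ μ → Filter.Tendsto (fun n => ∫ ω, clampReal n (φ ω) ∂μ)
      Filter.atTop (nhds (∫ ω, φ ω ∂μ)) := fun {φ} hφ =>
    tendsto_integral_of_dominated_convergence (fun ω => |φ ω|) (fun n => mc hφ n) hφ.abs
      (fun n => .of_forall fun ω => abs_clampReal_le n _) (.of_forall fun ω => tendsto_clampReal _)
  have limfg : Filter.Tendsto (fun n => ∫ ω, clampReal n (f ω) * clampReal n (g ω) ∂μ)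
      Filter.atTop (nhds (∫ ω, f ω * g ω ∂μ)) := by
    refine tendsto_integral_of_dominated_convergence (fun ω => |f ω * g ω|)
      (fun n => (mc hf n).mul (mc hg n)) hfg.abs (fun n => .of_forall fun ω => ?_)
      (.of_forall fun ω => (tendsto_clampReal _).mul (tendsto_clampReal _))
    simp only [Real.norm_eq_abs, abs_mul]
    exact mul_le_mul (abs_clampReal_le n _) (abs_clampReal_le n _) (abs_nonneg _) (abs_nonneg _)
  have key : ∀ n : ℕ, ∫ ω, clampReal n (f ω) * clampReal n (g ω) ∂μ ≤
      (∫ ω, clampReal n (f ω) ∂μ) * ∫ ω, clampReal n (g ω) ∂μ := by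
    intro n
    have nn : ∀ (φ : Ω → ℝ) ω, 0 ≤ clampReal n (φ ω) + n := fun φ ω => by
      linarith [neg_le_clampReal n (φ ω)]
    have ip : ∀ {φ : Ω → ℝ}, Integrable φ μ → Integrable (fun ω => clampReal n (φ ω) + n) μ :=
      fun hφ => (ic hφ n).add (integrable_const _)
    obtain ⟨ipp, epp⟩ := integral_sub_mul_sub (ic hf n) (ic hg n) (ifg n) (-n) (-n)
    simp only [sub_neg_eq_add] at ipp epp
    have hn := h n
    simp only [← ENNReal.ofReal_mul (nn f _)] at hn
    rw [← ofReal_integral_eq_lintegral_ofReal (ip hf) (.of_forall (nn f)),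
      ← ofReal_integral_eq_lintegral_ofReal (ip hg) (.of_forall (nn g)),
      ← ofReal_integral_eq_lintegral_ofReal ipp
        (.of_forall fun ω => mul_nonneg (nn f ω) (nn g ω)),
      ← ENNReal.ofReal_mul (integral_nonneg (nn f)),
      ENNReal.ofReal_le_ofReal_iff (mul_nonneg (integral_nonneg (nn f)) (integral_nonneg (nn g)))]
      at hn
    have e2 : ∀ {φ : Ω → ℝ}, Integrable φ μ →
        ∫ ω, (clampReal n (φ ω) + n) ∂μ = ∫ ω, clampReal n (φ ω) ∂μ + n := fun hφ => by
      rw [integral_add (ic hφ n) (integrable_const _)]; simp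
    rw [epp, e2 hf, e2 hg] at hn
    linarith
  have main : ∫ ω, f ω * g ω ∂μ ≤ (∫ ω, f ω ∂μ) * ∫ ω, g ω ∂μ :=
    le_of_tendsto_of_tendsto' limfg ((lim hf).mul (lim hg)) key
  have hcov : covariance f g μ = ∫ ω, f ω * g ω ∂μ - (∫ ω, f ω ∂μ) * ∫ ω, g ω ∂μ := by
    rw [covariance, (integral_sub_mul_sub hf hg hfg _ _).2]
    ring
  linarith

-- Allows A_e to be replaced by a version that is monotone on the whole sample space, not only where
-- T_e lies in [0, 1].
omit [IsProbabilityMeasure μ] in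
theorem NegativelyAssociated.congr {ι : Type*} [Countable ι] {X Y : ι → Ω → ℝ}
    (hX : NegativelyAssociated X μ) (h : ∀ i, X i =ᵐ[μ] Y i) : NegativelyAssociated Y μ := by
  intro s t hst f g hf hg hfm hgm hfi hgi hfgi
  have hall : ∀ᵐ ω ∂μ, ∀ i, X i ω = Y i ω := ae_all_iff.2 h
  have e : ∀ (u : Set ι) (φ : (u → ℝ) → ℝ),
      (fun ω => φ fun i => X i ω) =ᵐ[μ] fun ω => φ fun i => Y i ω := fun u φ =>
    hall.mono fun ω hω => by simp only [hω]
  have hc : covariance (fun ω => f fun i => Y i ω) (fun ω => g fun i => Y i ω) μ =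
      covariance (fun ω => f fun i => X i ω) (fun ω => g fun i => X i ω) μ := by
    rw [covariance, covariance, integral_congr_ae (e s f), integral_congr_ae (e t g)]
    refine integral_congr_ae ?_
    filter_upwards [e s f, e t g] with ω h1 h2
    rw [h1, h2]
  rw [hc]
  exact hX s t hst f g hf hg hfm hgm (hfi.congr (e s f).symm) (hgi.congr (e t g).symm)
    (hfgi.congr ((e s f).mul (e t g)).symm)

end Covariance

/-! ### The Beta distribution and the probability integral transform -/

/-- The uniform distribution on `[0, 1]`. -/
def uniformLaw : Measure ℝ := volume.restrict (Set.Icc 0 1)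

instance isProbabilityMeasure_uniformLaw : IsProbabilityMeasure uniformLaw :=
  ⟨by simp [uniformLaw]⟩

theorem uniformLaw_Iic {a : ℝ} (ha1 : a ≤ 1) :
    uniformLaw (Set.Iic a) = ENNReal.ofReal a := by
  rw [uniformLaw, Measure.restrict_apply measurableSet_Iic]
  have : Set.Iic a ∩ Set.Icc 0 1 = Set.Icc 0 a := by
    ext y
    simp only [Set.mem_inter_iff, Set.mem_Iic, Set.mem_Icc]
    exact ⟨fun h => ⟨h.2.1, h.1⟩, fun h => ⟨h.2, h.1, h.2.trans ha1⟩⟩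
  rw [this, Real.volume_Icc, sub_zero]

theorem uniformLaw_Iio {a : ℝ} (ha1 : a ≤ 1) :
    uniformLaw (Set.Iio a) = ENNReal.ofReal a := by
  rw [uniformLaw, Measure.restrict_apply measurableSet_Iio]
  have : Set.Iio a ∩ Set.Icc 0 1 = Set.Ico 0 a := by
    ext y
    simp only [Set.mem_inter_iff, Set.mem_Iio, Set.mem_Icc, Set.mem_Ico]
    exact ⟨fun h => ⟨h.2.1, h.1⟩, fun h => ⟨h.2, h.1, h.2.le.trans ha1⟩⟩
  rw [this, Real.volume_Ico, sub_zero]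

theorem lintegral_rpow_uniformLaw {q : ℝ} (hq : 0 ≤ q) :
    ∫⁻ y, ENNReal.ofReal (y ^ q) ∂uniformLaw = ENNReal.ofReal (1 / (q + 1)) := by
  have h0 : ∀ᵐ y ∂uniformLaw, 0 ≤ y ^ q :=
    ae_restrict_of_forall_mem measurableSet_Icc fun y hy => Real.rpow_nonneg hy.1 _
  have hi : IntervalIntegrable (fun y : ℝ => y ^ q) volume 0 1 :=
    intervalIntegral.intervalIntegrable_rpow (.inl hq)
  have hi' : Integrable (fun y : ℝ => y ^ q) uniformLaw := by
    rw [intervalIntegrable_iff_integrableOn_Icc_of_le zero_le_one] at hi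
    exact hi
  rw [← ofReal_integral_eq_lintegral_ofReal hi' h0, uniformLaw, integral_Icc_eq_integral_Ioc,
    ← intervalIntegral.integral_of_le zero_le_one, integral_rpow (.inl (by linarith))]
  rw [Real.one_rpow, Real.zero_rpow (by linarith), sub_zero]

theorem uniformLaw_ae_mem_Ioo : ∀ᵐ y ∂uniformLaw, y ∈ Set.Ioo (0 : ℝ) 1 := by
  rw [uniformLaw, ← Measure.restrict_congr_set Ioo_ae_eq_Icc]
  exact ae_restrict_mem measurableSet_Ioo

/-- The probability integral transform. -/
theorem map_cdf_eq_uniformLaw {ν : Measure ℝ} [IsProbabilityMeasure ν] (hν : ∀ z, ν {z} = 0) :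
    ν.map (cdf ν) = uniformLaw := by
  have hmeas : Measurable (cdf ν) := (monotone_cdf ν).measurable
  have hp : IsProbabilityMeasure (ν.map (cdf ν)) := Measure.isProbabilityMeasure_map hmeas.aemeasurable
  refine Measure.ext_of_Iic _ _ fun a => ?_
  rw [Measure.map_apply hmeas measurableSet_Iic]
  rcases le_or_gt 1 a with h1 | h1
  · have e1 : cdf ν ⁻¹' Set.Iic a = Set.univ :=
      Set.eq_univ_of_forall fun y => (cdf_le_one ν y).trans h1
    have e2 : uniformLaw (Set.Iic a) = 1 := by
      refine le_antisymm prob_le_one ?_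
      calc (1 : ℝ≥0∞) = uniformLaw (Set.Iic 1) := by rw [uniformLaw_Iic le_rfl]; simp
        _ ≤ _ := measure_mono (Set.Iic_subset_Iic.2 h1)
    rw [e1, e2, measure_univ]
  rw [uniformLaw_Iic h1.le]
  have key : ∀ w, cdf ν w = a → (∀ y, w < y → a < cdf ν y) →
      ν (cdf ν ⁻¹' Set.Iic a) = ENNReal.ofReal a := by
    intro w hw hy
    have : cdf ν ⁻¹' Set.Iic a = Set.Iic w := by
      ext y
      simp only [Set.mem_preimage, Set.mem_Iic]
      exact ⟨fun h => not_lt.1 fun h' => (hy y h').not_ge h, fun h => hw ▸ monotone_cdf ν h⟩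
    rw [this, ← ofReal_cdf, hw]
  -- This sublevel set is empty (which forces a ≤ 0) or the half-line up to its supremum w. In the
  -- latter case its measure is the distribution function at w, to be shown equal to a.
  set S : Set ℝ := cdf ν ⁻¹' Set.Iic a with hS
  by_cases hne : S.Nonempty
  · have hbdd : BddAbove S := by
      obtain ⟨M, hM⟩ := ((tendsto_cdf_atTop ν).eventually (lt_mem_nhds h1)).exists
      exact ⟨M, fun y hy => not_lt.1 fun h => (hM.trans_le (monotone_cdf ν h.le)).not_ge hy⟩
    set w := sSup S with hw
    have above : ∀ y, w < y → a < cdf ν y := fun y hy =>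
      not_le.1 fun h => (le_csSup hbdd h).not_gt hy
    have below : ∀ y, y < w → cdf ν y ≤ a := fun y hy => by
      obtain ⟨z, hz, hyz⟩ := exists_lt_of_lt_csSup hne hy
      exact (monotone_cdf ν hyz.le).trans hz
    -- Without an atom at w the distribution function does not jump there.
    have hleft : cdf ν w ≤ Function.leftLim (cdf ν) w := by
      have h := (cdf ν).measure_singleton w
      rw [measure_cdf, hν, eq_comm, ENNReal.ofReal_eq_zero] at h
      linarith
    have hle : cdf ν w ≤ a :=
      hleft.trans (le_of_tendsto ((monotone_cdf ν).tendsto_leftLim w)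
        (Filter.eventually_of_mem self_mem_nhdsWithin below))
    have hge : a ≤ cdf ν w := by
      have := ((cdf ν).right_continuous w).mono_left (nhdsWithin_mono w Set.Ioi_subset_Ici_self)
      exact ge_of_tendsto this
        (Filter.eventually_of_mem self_mem_nhdsWithin fun y hy => (above y hy).le)
    exact key w (le_antisymm hle hge) above
  · have ha : a ≤ 0 := by
      by_contra! h
      obtain ⟨M, hM⟩ := ((tendsto_cdf_atBot ν).eventually (gt_mem_nhds h)).exists
      exact hne ⟨M, hM.le⟩
    rw [Set.not_nonempty_iff_eq_empty.1 hne, measure_empty, ENNReal.ofReal_of_nonpos ha]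

theorem betaMeasure_singleton (a b z : ℝ) : betaMeasure a b {z} = 0 :=
  withDensity_absolutelyContinuous _ _ Real.volume_singleton

theorem regIncompleteBeta_eq_cdf {a b : ℝ} (ha : 0 < a) (hb : 0 < b) {z : ℝ}
    (hz : z ∈ Set.Icc (0 : ℝ) 1) : regIncompleteBeta z a b = cdf (betaMeasure a b) z := by
  have := isProbabilityMeasureBeta ha hb
  have hpos : 0 < beta a b := beta_pos ha hb
  rw [cdf_eq_real, measureReal_def, betaMeasure, withDensity_apply _ measurableSet_Iic,
    ← lintegral_indicator measurableSet_Iic]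
  -- The point t = 1 is left out: `betaPDF` vanishes there, while the formula need not, as 0 ^ 0 =
  -- 1.
  have e1 : ∀ᵐ t : ℝ, (Set.Iic z).indicator (betaPDF a b) t =
      (Set.Ioc 0 z).indicator
        (fun t => ENNReal.ofReal (t ^ (a - 1) * (1 - t) ^ (b - 1) / beta a b)) t := by
    filter_upwards [Measure.ae_ne volume (1 : ℝ)] with t ht
    by_cases h : t ∈ Set.Ioc 0 z
    · rw [Set.indicator_of_mem h, Set.indicator_of_mem (Set.mem_Iic.2 h.2),
        betaPDF_of_pos_lt_one h.1 (lt_of_le_of_ne (h.2.trans hz.2) ht)]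
      congr 1
      ring
    · rw [Set.indicator_of_notMem h]
      by_cases h' : t ≤ z
      · rw [Set.indicator_of_mem (Set.mem_Iic.2 h'), betaPDF_eq_zero_of_nonpos]
        exact not_lt.1 fun h0 => h ⟨h0, h'⟩
      · rw [Set.indicator_of_notMem (by simpa using h')]
  rw [lintegral_congr_ae e1, lintegral_indicator measurableSet_Ioc, regIncompleteBeta,
    incompleteBeta, intervalIntegral.integral_of_le hz.1, ← integral_div,
    integral_eq_lintegral_of_nonneg_ae]
  · refine ae_restrict_of_forall_mem measurableSet_Ioc fun t ht => ?_
    have h1 : 0 ≤ 1 - t := by linarith [ht.2, hz.2]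
    have h2 : 0 ≤ t := ht.1.le
    exact div_nonneg (mul_nonneg (Real.rpow_nonneg h2 _) (Real.rpow_nonneg h1 _)) hpos.le
  · exact Measurable.aestronglyMeasurable (by fun_prop)

theorem measurable_betaPDF (a b : ℝ) : Measurable (betaPDF a b) :=
  (measurable_betaPDFReal a b).ennreal_ofReal

theorem map_eval_dirichlet_unit {a b : ℝ} (ha : 0 < a) (hb : 0 < b) :
    (dirichlet (fun _ : Unit => a) b).map (fun t => t ()) = betaMeasure a b := by
  rw [dirichlet_eq_withDensity _ _ (fun _ => ha) hb]
  refine Measure.ext_of_lintegral _ fun F hF => ?_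
  have hD : Measurable fun t : Unit → ℝ => if (∀ i, 0 ≤ t i) ∧ ∑ i, t i ≤ 1 then
        ENNReal.ofReal (Real.Gamma (∑ _i : Unit, a + b) /
          ((∏ _i : Unit, Real.Gamma a) * Real.Gamma b) *
          ((1 - ∑ i, t i) ^ (b - 1) * ∏ i, t i ^ (a - 1))) else 0 := by
    refine Measurable.ite ?_ (by fun_prop) measurable_const
    simp only [Finset.univ_unique, Finset.sum_singleton, Unique.forall_iff]
    exact (measurableSet_Icc (a := (0 : ℝ)) (b := 1)).preimage (measurable_pi_apply default)
  rw [lintegral_map hF (by fun_prop),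
    lintegral_withDensity_eq_lintegral_mul _ hD (by fun_prop), betaMeasure,
    lintegral_withDensity_eq_lintegral_mul _ (measurable_betaPDF a b) hF,
    ← (volume_preserving_funUnique Unit ℝ).lintegral_comp
      (f := betaPDF a b * F) ((measurable_betaPDF a b).mul hF)]
  have hne : ∀ c : ℝ, ∀ᵐ t : Unit → ℝ, t () ≠ c := fun c =>
    (volume_preserving_funUnique Unit ℝ).quasiMeasurePreserving.ae (Measure.ae_ne volume c)
  refine lintegral_congr_ae ?_
  filter_upwards [hne 0, hne 1] with t h0 h1
  simp only [Pi.mul_apply, Finset.univ_unique, Finset.sum_singleton, Finset.prod_singleton,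
    Unique.forall_iff, PUnit.default_eq_unit, MeasurableEquiv.funUnique_apply]
  change _ = betaPDF a b (t ()) * F (t ())
  congr 1
  rw [betaPDF_eq]
  by_cases h : 0 ≤ t () ∧ t () ≤ 1
  · rw [if_pos h, if_pos ⟨lt_of_le_of_ne h.1 h0.symm, lt_of_le_of_ne h.2 h1⟩]
    congr 1
    rw [beta, one_div_div]
    ring
  · rw [if_neg h, if_neg fun h' => h ⟨h'.1.le, h'.2.le⟩, ENNReal.ofReal_zero]

/-- Since all parameters sum to 1, those other than ρ i lump together into 1 - ρ i. -/
theorem map_eval_dirichlet {ι : Type*} [Fintype ι] {ρ : ι → ℝ} {ρ₀ : ℝ} (hρ : ∀ i, 0 ≤ ρ i)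
    (h0 : 0 ≤ ρ₀) (i : ι) (hi : 0 < ρ i) (hsum : ∑ j, ρ j + ρ₀ = 1) (hi1 : ρ i < 1) :
    (dirichlet ρ ρ₀).map (fun t => t i) = betaMeasure (ρ i) (1 - ρ i) := by
  have h := map_comp_injective_dirichlet (j := fun _ : Unit => i)
    (fun _ _ _ => Subsingleton.elim _ _) hρ h0
  have h1 : ∑ j, ρ j - ∑ _k : Unit, ρ i + ρ₀ = 1 - ρ i := by
    rw [← hsum]; simp; ring
  rw [h1] at h
  rw [← map_eval_dirichlet_unit hi (sub_pos.2 hi1)]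
  have h2 := congrArg (Measure.map fun t : Unit → ℝ => t ()) h
  rw [Measure.map_map (by fun_prop) (by fun_prop)] at h2
  exact h2

/-! ### The variables of the rounding algorithm -/


namespace DepRound

variable {U V : Type*} [DecidableEq U] [DecidableEq V] (E : Finset (U × V))

/-- The law of the random vector at the left-node `u`. -/
abbrev nodeLaw (ρ : E → ℝ) (u : U) : Measure (LeftNbr E u → ℝ) :=
  dirichlet (fun e : LeftNbr E u => ρ e) (1 - ∑ e : LeftNbr E u, ρ e)

instance isProbabilityMeasure_law [Fintype U] (ρ : E → ℝ) : IsProbabilityMeasure (law E ρ) := by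
  unfold law
  infer_instance

/-- The value of the cumulative distribution function of `Beta(ρ_e, 1 - ρ_e)` at `T_e`; this is
an everywhere monotone version of `A_e`. -/
def uniformVar (ρ : E → ℝ) (e : E) (ω : Sample E) : ℝ :=
  cdf (betaMeasure (ρ e) (1 - ρ e)) (T E e ω)

theorem measurable_T (e : E) : Measurable (T E e) := by unfold T; fun_prop

theorem measurable_uniformVar (ρ : E → ℝ) (e : E) : Measurable (uniformVar E ρ e) :=
  (monotone_cdf _).measurable.comp (measurable_T E e)

theorem monotone_uniformVar (ρ : E → ℝ) (e : E) : Monotone (uniformVar E ρ e) := fun _ _ h =>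
  monotone_cdf _ (h e.1.1 ⟨e, rfl⟩)

theorem uniformVar_nonneg (ρ : E → ℝ) (e : E) (ω : Sample E) : 0 ≤ uniformVar E ρ e ω :=
  cdf_nonneg _ _

theorem uniformVar_le_one (ρ : E → ℝ) (e : E) (ω : Sample E) : uniformVar E ρ e ω ≤ 1 :=
  cdf_le_one _ _

theorem uniformVar_congr (ρ : E → ℝ) (e : E) {ω ω' : Sample E} (h : ω e.1.1 = ω' e.1.1) :
    uniformVar E ρ e ω = uniformVar E ρ e ω' := by
  simp [uniformVar, T, h]

/-- The coordinates which belong to a set of edges. -/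
def coords (s : Set E) : Set (Σ u, LeftNbr E u) := {p | p.2.1 ∈ s}

theorem disjoint_coords {s t : Set E} (h : Disjoint s t) : Disjoint (coords E s) (coords E t) :=
  Set.disjoint_left.2 fun _ hp hp' => Set.disjoint_left.1 h hp hp'

theorem uniformVar_congr_of_coords (ρ : E → ℝ) {s : Set E} {ω ω' : Sample E}
    (h : ∀ p ∈ coords E s, ω p.1 p.2 = ω' p.1 p.2) {e : E} (he : e ∈ s) :
    uniformVar E ρ e ω = uniformVar E ρ e ω' := by
  have : T E e ω = T E e ω' := h ⟨e.1.1, ⟨e, rfl⟩⟩ he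
  simp [uniformVar, this]

/-! ### Laws and dependence of A and Z -/

section Law

variable [Fintype U] {E} {ρ : E → ℝ} (hρ : ∀ e, 0 < ρ e) (hρ1 : ∀ e, ρ e < 1)
  (hρU : ∀ u : U, ∑ e : LeftNbr E u, ρ e ≤ 1)

theorem map_node_law (ρ : E → ℝ) (u : U) : (law E ρ).map (fun ω => ω u) = nodeLaw E ρ u :=
  (measurePreserving_eval (nodeLaw E ρ) u).map_eq

theorem T_ae_mem_Icc (ρ : E → ℝ) (e : E) : ∀ᵐ ω ∂law E ρ, T E e ω ∈ Set.Icc 0 1 := by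
  have h := dirichlet_ae_mem_Icc (fun f : LeftNbr E e.1.1 => ρ f) (1 - ∑ f : LeftNbr E e.1.1, ρ f)
  filter_upwards [(measurePreserving_eval (nodeLaw E ρ) e.1.1).quasiMeasurePreserving.ae h]
    with ω hω using hω ⟨e, rfl⟩

include hρ hρ1 in
theorem A_ae_eq_uniformVar (e : E) : A E ρ e =ᵐ[law E ρ] uniformVar E ρ e := by
  filter_upwards [T_ae_mem_Icc ρ e] with ω hω
  exact regIncompleteBeta_eq_cdf (hρ e) (sub_pos.2 (hρ1 e)) hω

include hρ hρU in
theorem negAssocLaw_nodeLaw (u : U) : NegAssocLaw (nodeLaw E ρ u) :=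
  negAssocLaw_dirichlet (fun e => (hρ e).le) (sub_nonneg.2 (hρU u))

include hρ hρ1 hρU

theorem map_cdf_nodeLaw (e : E) : (nodeLaw E ρ e.1.1).map
    (fun y => cdf (betaMeasure (ρ e) (1 - ρ e)) (y ⟨e, rfl⟩)) = uniformLaw := by
  have := isProbabilityMeasureBeta (hρ e) (sub_pos.2 (hρ1 e))
  rw [← map_cdf_eq_uniformLaw (betaMeasure_singleton (ρ e) (1 - ρ e)),
    ← map_eval_dirichlet (ρ := fun f : LeftNbr E e.1.1 => ρ f) (fun f => (hρ f).le)
      (sub_nonneg.2 (hρU e.1.1)) ⟨e, rfl⟩ (hρ e) (by ring) (hρ1 e),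
    Measure.map_map (monotone_cdf _).measurable (by fun_prop)]
  rfl

theorem map_uniformVar (e : E) : (law E ρ).map (uniformVar E ρ e) = uniformLaw := by
  have hm : Measurable fun y : LeftNbr E e.1.1 → ℝ =>
      cdf (betaMeasure (ρ e) (1 - ρ e)) (y ⟨e, rfl⟩) :=
    (monotone_cdf _).measurable.comp (measurable_pi_apply _)
  rw [← map_cdf_nodeLaw hρ hρ1 hρU e, ← map_node_law, Measure.map_map hm (measurable_pi_apply _)]
  rfl

theorem uniformVar_ae_mem_Ioo : ∀ᵐ ω ∂law E ρ, ∀ e, uniformVar E ρ e ω ∈ Set.Ioo (0 : ℝ) 1 := by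
  refine ae_all_iff.2 fun e => ?_
  have h := uniformLaw_ae_mem_Ioo
  rw [← map_uniformVar hρ hρ1 hρU e] at h
  exact ae_of_ae_map (measurable_uniformVar E ρ e).aemeasurable h

theorem A_ae_eq_and_mem_Ioo : ∀ᵐ ω ∂law E ρ,
    ∀ e, A E ρ e ω = uniformVar E ρ e ω ∧ uniformVar E ρ e ω ∈ Set.Ioo (0 : ℝ) 1 := by
  filter_upwards [uniformVar_ae_mem_Ioo hρ hρ1 hρU, ae_all_iff.2 (A_ae_eq_uniformVar hρ hρ1)]
    with ω h h' e using ⟨h' e, h e⟩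

theorem negativelyAssociated_A : NegativelyAssociated (A E ρ) (law E ρ) := by
  refine NegativelyAssociated.congr ?_ fun e => (A_ae_eq_uniformVar hρ hρ1 e).symm
  intro s t hst f g hf hg hfm hgm hfi hgi hfgi
  refine covariance_nonpos_of_lintegral_clampReal hfi hgi hfgi fun n => ?_
  have meas : ∀ {r : Set E} {φ : (r → ℝ) → ℝ}, Measurable φ → Measurable fun ω : Sample E =>
      ENNReal.ofReal (clampReal n (φ fun i => uniformVar E ρ i ω) + n) := fun hφ =>
    (((measurable_clampReal n).comp (hφ.comp (measurable_pi_iff.2 fun i =>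
      measurable_uniformVar E ρ i))).add_const _).ennreal_ofReal
  have mono : ∀ {r : Set E} {φ : (r → ℝ) → ℝ}, Monotone φ → Monotone fun ω : Sample E =>
      ENNReal.ofReal (clampReal n (φ fun i => uniformVar E ρ i ω) + n) := fun hφ ω ω' h =>
    ENNReal.ofReal_le_ofReal (add_le_add_left (monotone_clampReal n (hφ fun i =>
      monotone_uniformVar E ρ i h)) _)
  have dep : ∀ {r : Set E} {φ : (r → ℝ) → ℝ}, DependsOnCoords (fun ω : Sample E =>
      ENNReal.ofReal (clampReal n (φ fun i => uniformVar E ρ i ω) + n)) (coords E r) := by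
    intro r φ ω ω' h
    have : (fun i : r => uniformVar E ρ i ω) = fun i : r => uniformVar E ρ i ω' :=
      funext fun i => uniformVar_congr_of_coords E ρ h i.2
    simp only [this]
  have := lmarginal_mul_le (negAssocLaw_nodeLaw hρ hρU) (disjoint_coords E hst) (meas hfm)
    (meas hgm) dep dep (.inl ⟨mono hf, mono hg⟩) Finset.univ 0
  simp only [lmarginal_univ] at this
  exact this

theorem Z_ae_eq (x : E → ℝ) (e : E) :
    Z E x ρ e =ᵐ[law E ρ] fun ω => -Real.log (uniformVar E ρ e ω) / x e := by
  filter_upwards [A_ae_eq_uniformVar hρ hρ1 e] with ω hω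
  simp [Z, hω]

/-- Edges at one right-node have distinct left-nodes, whose random vectors are independent. -/
theorem iIndepFun_Z (x : E → ℝ) (v : V) :
    iIndepFun (fun e : RightNbr E v => Z E x ρ e) (law E ρ) := by
  refine iIndepFun.congr (fun e => (Z_ae_eq hρ hρ1 hρU x e).symm) ?_
  have h1 : iIndepFun (fun u (ω : Sample E) => ω u) (law E ρ) :=
    iIndepFun_pi (μ := nodeLaw E ρ) (X := fun u y => y) fun u => aemeasurable_id
  have hj : (fun e : RightNbr E v => e.1.1.1).Injective := by
    intro e f h
    exact Subtype.ext (Subtype.ext (Prod.ext h (e.2.trans f.2.symm)))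
  have h2 := h1.precomp hj
  exact h2.comp (fun e y => -Real.log (cdf (betaMeasure (ρ e) (1 - ρ e)) (y ⟨e.1, rfl⟩)) / x e)
    fun e => ((Real.measurable_log.comp ((monotone_cdf _).measurable.comp
      (measurable_pi_apply _))).neg).div_const _

omit hρ hρ1 hρU in
omit [Fintype U] [DecidableEq U] [DecidableEq V] in
theorem _root_.map_neg_log_div_uniformLaw {r : ℝ} (hr : 0 < r) :
    uniformLaw.map (fun y => -Real.log y / r) = expMeasure r := by
  have hm : Measurable fun y : ℝ => -Real.log y / r := by fun_prop
  have := isProbabilityMeasure_expMeasure hr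
  have : IsProbabilityMeasure (uniformLaw.map fun y => -Real.log y / r) :=
    Measure.isProbabilityMeasure_map hm.aemeasurable
  refine Measure.eq_of_cdf _ _ (StieltjesFunction.ext fun z => ?_)
  rw [cdf_expMeasure_eq hr, cdf_eq_real, measureReal_def, Measure.map_apply hm measurableSet_Iic]
  have hset : uniformLaw ((fun y => -Real.log y / r) ⁻¹' Set.Iic z) =
      uniformLaw (Set.Iio (Real.exp (-(r * z))))ᶜ := by
    refine measure_congr ?_
    filter_upwards [uniformLaw_ae_mem_Ioo] with y hy
    refine propext ?_
    change -Real.log y / r ≤ z ↔ ¬ y < Real.exp (-(r * z))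
    rw [div_le_iff₀ hr, not_lt, ← Real.le_log_iff_exp_le hy.1]
    constructor <;> intro h <;> linarith
  rw [hset]
  split_ifs with hz
  · have hle : Real.exp (-(r * z)) ≤ 1 := Real.exp_le_one_iff.2 (by nlinarith)
    rw [prob_compl_eq_one_sub measurableSet_Iio, uniformLaw_Iio hle,
      ENNReal.toReal_sub_of_le (by simpa using hle) ENNReal.one_ne_top,
      ENNReal.toReal_ofReal (Real.exp_pos _).le, ENNReal.toReal_one]
  · have : uniformLaw (Set.Iio (Real.exp (-(r * z))))ᶜ = 0 := by
      rw [← mem_ae_iff]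
      filter_upwards [uniformLaw_ae_mem_Ioo] with y hy
      have : 1 < Real.exp (-(r * z)) := Real.one_lt_exp_iff.2 (by nlinarith)
      exact hy.2.trans this
    rw [this, ENNReal.toReal_zero]

theorem hasLaw_Z {x : E → ℝ} (hx : ∀ e, 0 < x e) (e : E) :
    HasLaw (Z E x ρ e) (expMeasure (x e)) (law E ρ) := by
  have hm : Measurable fun ω => -Real.log (uniformVar E ρ e ω) / x e := by
    have := measurable_uniformVar E ρ e
    fun_prop
  have hae := Z_ae_eq hρ hρ1 hρU x e
  refine ⟨hm.aemeasurable.congr hae.symm, ?_⟩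
  rw [Measure.map_congr hae, ← map_neg_log_div_uniformLaw (hx e), ← map_uniformVar hρ hρ1 hρU e,
    Measure.map_map (by fun_prop) (measurable_uniformVar E ρ e)]
  rfl

end Law

/-! ### Competing edges at a right-node -/

section Weights

variable {E} {x : E → ℝ}

/-- The edges which share their right-node with `e`, other than `e`. -/
def others (e : E) : Finset E := Finset.univ.filter fun f => f.1.2 = e.1.2 ∧ f ≠ e

theorem mem_others {e f : E} : f ∈ others e ↔ f.1.2 = e.1.2 ∧ f ≠ e := by simp [others]

theorem sum_others (x : E → ℝ) (e : E) :
    ∑ f ∈ others e, x f = rightWeight E x e.1.2 - x e := by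
  have h : rightWeight E x e.1.2 = ∑ f ∈ Finset.univ.filter fun f : E => f.1.2 = e.1.2, x f := by
    rw [rightWeight]
    exact (Finset.sum_subtype _ (by simp) x).symm
  have h2 : others e = (Finset.univ.filter fun f : E => f.1.2 = e.1.2).erase e := by
    ext f
    simp [mem_others, and_comm]
  rw [h, h2, ← Finset.sum_erase_add (Finset.univ.filter fun f : E => f.1.2 = e.1.2) x (a := e)
    (by simp), add_sub_cancel_right]

theorem le_rightWeight (hx : ∀ e, 0 < x e) (e : E) : x e ≤ rightWeight E x e.1.2 := by
  have := sum_others x e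
  have h : 0 ≤ ∑ f ∈ others e, x f := Finset.sum_nonneg fun f _ => (hx f).le
  linarith

theorem lt_rightWeight_of_mem_others (hx : ∀ e, 0 < x e) {e f : E} (hf : f ∈ others e) :
    x e < rightWeight E x e.1.2 := by
  have := sum_others x e
  have h : 0 < ∑ f ∈ others e, x f := Finset.sum_pos (fun f _ => hx f) ⟨f, hf⟩
  linarith

/-- As x(N(v)) ≤ 1, the factor on the right of the selection rule is at most 1 - x_e. A selected
edge thus has strictly smaller Z than every competitor. -/
theorem eq_of_X_eq_one (hx : ∀ e, 0 < x e) (hxV : ∀ v : V, rightWeight E x v ≤ 1) {ρ : E → ℝ}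
    {ω : Sample E} (hZ : ∀ e, 0 ≤ Z E x ρ e ω) {e f : E} (hef : e.1.2 = f.1.2)
    (he : X E x ρ e ω = 1) (hf : X E x ρ f ω = 1) : e = f := by
  by_contra hne
  have key : ∀ e f : E, e.1.2 = f.1.2 → e ≠ f → X E x ρ e ω = 1 →
      Z E x ρ e ω < Z E x ρ f ω := by
    intro e f hef hne he
    have h : ∀ f : E, f.1.2 = e.1.2 → f ≠ e →
        (1 - x e) * Z E x ρ e ω < (rightWeight E x e.1.2 - x e) * Z E x ρ f ω := by
      by_contra h
      simp [X, if_neg h] at he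
    have h1 := h f hef.symm hne.symm
    have h2 : (rightWeight E x e.1.2 - x e) * Z E x ρ f ω ≤ (1 - x e) * Z E x ρ f ω :=
      mul_le_mul_of_nonneg_right (sub_le_sub_right (hxV _) _) (hZ f)
    have h3 : 0 ≤ 1 - x e := sub_nonneg.2 ((le_rightWeight hx e).trans (hxV _))
    exact lt_of_mul_lt_mul_left (h1.trans_le h2) h3
  exact lt_asymm (key e f hef hne he) (key f e hef.symm (Ne.symm hne) hf)

theorem Z_nonneg (hx : ∀ e, 0 < x e) {ρ : E → ℝ} {ω : Sample E} {e : E}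
    (h : A E ρ e ω ∈ Set.Ioo (0 : ℝ) 1) : 0 ≤ Z E x ρ e ω :=
  div_nonneg (neg_nonneg.2 (Real.log_nonpos h.1.le h.2.le)) (hx e).le

end Weights

end DepRound

theorem lmarginal_comp_eval {U : Type*} [DecidableEq U] {X : U → Type*} [∀ u, MeasurableSpace (X u)]
    {μ : ∀ u, Measure (X u)} [∀ u, IsProbabilityMeasure (μ u)] {F : Finset U} {u : U} (hu : u ∈ F)
    {G : X u → ℝ≥0∞} (hG : Measurable G) (ω : ∀ u, X u) :
    lmarginal μ F (fun ω => G (ω u)) ω = ∫⁻ y, G y ∂μ u := by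
  rw [← (measurePreserving_eval (fun i : F => μ i) ⟨u, hu⟩).lintegral_comp hG]
  refine lintegral_congr fun y => ?_
  simp [Function.updateFinset, hu]

theorem lmarginal_eq_self_of_dependsOn {U : Type*} [DecidableEq U] {X : U → Type*}
    [∀ u, MeasurableSpace (X u)] {μ : ∀ u, Measure (X u)} [∀ u, IsProbabilityMeasure (μ u)]
    {F : Finset U} {f : (∀ u, X u) → ℝ≥0∞} {ω : ∀ u, X u}
    (h : ∀ ω', (∀ u ∉ F, ω' u = ω u) → f ω' = f ω) : lmarginal μ F f ω = f ω := by
  have : ∀ y, f (Function.updateFinset ω F y) = f ω := fun y => h _ fun u hu => by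
    simp [Function.updateFinset, hu]
  simp [lmarginal, this]

/-! ### Selection as a product of threshold indicators -/

namespace DepRound

variable {U V : Type*} [DecidableEq U] [DecidableEq V] {E : Finset (U × V)}

/-- The exponent `c` for which, almost surely, `Z_f` is large enough for the selection of `e` if
and only if `A_f < A_e ^ c`. -/
def expo (x : E → ℝ) (e f : E) : ℝ :=
  (1 - x e) * x f / ((rightWeight E x e.1.2 - x e) * x e)

/-- The indicator of `A_f < A_e ^ c`, where `A_e` and `A_f` are evaluated at different samples. -/
def belowInd (x ρ : E → ℝ) (e f : E) (ω ω' : Sample E) : ℝ≥0∞ :=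
  if uniformVar E ρ f ω' < uniformVar E ρ e ω ^ expo x e f then 1 else 0

section Weights

variable {x : E → ℝ} (hx : ∀ e, 0 < x e) (hxV : ∀ v : V, rightWeight E x v ≤ 1)

include hx hxV in
theorem le_one (e : E) : x e ≤ 1 := (le_rightWeight hx e).trans (hxV _)

include hx hxV in
theorem inv_sub_one_nonneg (e : E) : 0 ≤ 1 / x e - 1 :=
  sub_nonneg.2 ((one_le_div (hx e)).2 (le_one hx hxV e))

include hx hxV in
theorem expo_nonneg {e f : E} (hf : f ∈ others e) : 0 ≤ expo x e f :=
  div_nonneg (mul_nonneg (sub_nonneg.2 (le_one hx hxV e)) (hx f).le)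
    (mul_nonneg (sub_nonneg.2 (lt_rightWeight_of_mem_others hx hf).le) (hx e).le)

-- The competitors' weights sum to x(N(v)) - x_e, which cancels the denominator; the selection rule
-- is calibrated for this. If x_e = 1, every exponent is 0.
include hx in
theorem sum_expo (hxE : ∀ e : E, x e = 1 ∨ x e < rightWeight E x e.1.2) (e : E) :
    ∑ f ∈ others e, expo x e f = 1 / x e - 1 := by
  have h := sum_others x e
  have he := (hx e).ne'
  unfold expo
  rw [← Finset.sum_div, ← Finset.mul_sum, h]
  rcases hxE e with h1 | h1
  · simp [h1]
  · have : rightWeight E x e.1.2 - x e ≠ 0 := (sub_pos.2 h1).ne'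
    field_simp

end Weights

theorem measurable_belowInd_right (x ρ : E → ℝ) (e f : E) (ω : Sample E) :
    Measurable (belowInd x ρ e f ω) :=
  Measurable.ite (measurableSet_lt (measurable_uniformVar E ρ f) measurable_const)
    measurable_const measurable_const

theorem measurable_belowInd (x ρ : E → ℝ) (e f : E) :
    Measurable fun ω => belowInd x ρ e f ω ω := by
  have h1 := measurable_uniformVar E ρ f
  have h2 := measurable_uniformVar E ρ e
  exact Measurable.ite (measurableSet_lt (by fun_prop) (by fun_prop)) measurable_const
    measurable_const

theorem antitone_belowInd (x ρ : E → ℝ) (e f : E) (ω : Sample E) :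
    Antitone (belowInd x ρ e f ω) := by
  intro ω' ω'' h
  unfold belowInd
  split_ifs with h1 h2
  · exact le_rfl
  · exact absurd ((monotone_uniformVar E ρ f h).trans_lt h1) h2
  · exact zero_le_one
  · exact le_rfl

/-- The real-valued power `A_e ^ (1 / x_e - 1)`. -/
def powerVar (x ρ : E → ℝ) (e : E) (ω : Sample E) : ℝ := uniformVar E ρ e ω ^ (1 / x e - 1)

theorem measurable_powerVar (x ρ : E → ℝ) (e : E) : Measurable (powerVar x ρ e) := by
  have := measurable_uniformVar E ρ e
  unfold powerVar
  fun_prop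

theorem powerVar_nonneg (x ρ : E → ℝ) (e : E) (ω : Sample E) : 0 ≤ powerVar x ρ e ω :=
  Real.rpow_nonneg (uniformVar_nonneg E ρ e ω) _

/-! ### Integrating out the competitors -/

section Main

variable [Fintype U] {x ρ : E → ℝ} (hρ : ∀ e, 0 < ρ e) (hρ1 : ∀ e, ρ e < 1)
  (hρU : ∀ u : U, ∑ e : LeftNbr E u, ρ e ≤ 1) (hx : ∀ e, 0 < x e)
  (hxV : ∀ v : V, rightWeight E x v ≤ 1)

-- Inserting Z = -log(A) / x and clearing positive factors turns each condition of the rule into a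
-- threshold for A_f alone.
include hx in
theorem ofReal_X_eq_prod_belowInd {ω : Sample E}
    (hω : ∀ e, A E ρ e ω = uniformVar E ρ e ω ∧ uniformVar E ρ e ω ∈ Set.Ioo (0 : ℝ) 1) (e : E) :
    ENNReal.ofReal (X E x ρ e ω) = ∏ f ∈ others e, belowInd x ρ e f ω ω := by
  have key : ∀ f ∈ others e, (1 - x e) * Z E x ρ e ω < (rightWeight E x e.1.2 - x e) *
      Z E x ρ f ω ↔ uniformVar E ρ f ω < uniformVar E ρ e ω ^ expo x e f := by
    intro f hf
    have hD : 0 < rightWeight E x e.1.2 - x e := sub_pos.2 (lt_rightWeight_of_mem_others hx hf)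
    have hxe := hx e
    have hxf := hx f
    rw [Z, Z, (hω e).1, (hω f).1, ← Real.log_lt_log_iff (hω f).2.1
      (Real.rpow_pos_of_pos (hω e).2.1 _), Real.log_rpow (hω e).2.1, expo]
    set D := rightWeight E x e.1.2 - x e
    set a := Real.log (uniformVar E ρ e ω)
    set b := Real.log (uniformVar E ρ f ω)
    have h1 : (1 - x e) * (-a / x e) = -((1 - x e) * x f / (D * x e) * a) * (D / x f) := by
      field_simp
    have h2 : D * (-b / x f) = -b * (D / x f) := by ring
    rw [h1, h2, mul_lt_mul_iff_left₀ (div_pos hD hxf), neg_lt_neg_iff]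
  by_cases h : ∀ f ∈ others e, uniformVar E ρ f ω < uniformVar E ρ e ω ^ expo x e f
  · rw [Finset.prod_eq_one fun f hf => by rw [belowInd, if_pos (h f hf)], X, if_pos,
      ENNReal.ofReal_one]
    exact fun f hf hfe => (key f (mem_others.2 ⟨hf, hfe⟩)).2 (h f (mem_others.2 ⟨hf, hfe⟩))
  · have h' := h
    push Not at h'
    obtain ⟨f, hf, hlt⟩ := h'
    rw [Finset.prod_eq_zero hf (by rw [belowInd, if_neg hlt.not_gt]), X, if_neg,
      ENNReal.ofReal_zero]
    exact fun hall => h fun f hf => (key f hf).1 (hall f (mem_others.1 hf).1 (mem_others.1 hf).2)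

-- With A_e frozen, A_f is uniform, so it falls below the threshold with probability equal to the
-- threshold. The threshold is at most 1 because the exponent is nonnegative.
include hρ hρ1 hρU hx hxV in
theorem lmarginal_belowInd {e f : E} (hf : f ∈ others e) {F : Finset U} (hfF : f.1.1 ∈ F)
    (ω ω' : Sample E) : lmarginal (nodeLaw E ρ) F (belowInd x ρ e f ω) ω' =
      ENNReal.ofReal (uniformVar E ρ e ω ^ expo x e f) := by
  set a := uniformVar E ρ e ω ^ expo x e f with ha
  have ha1 : a ≤ 1 := Real.rpow_le_one (uniformVar_nonneg E ρ e ω) (uniformVar_le_one E ρ e ω)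
    (expo_nonneg hx hxV hf)
  have hG : Measurable fun y : ℝ => (Set.Iio a).indicator (1 : ℝ → ℝ≥0∞) y :=
    measurable_one.indicator measurableSet_Iio
  have hc : Measurable fun y : LeftNbr E f.1.1 → ℝ =>
      cdf (betaMeasure (ρ f) (1 - ρ f)) (y ⟨f, rfl⟩) :=
    (monotone_cdf _).measurable.comp (measurable_pi_apply _)
  have := lmarginal_comp_eval (μ := nodeLaw E ρ) hfF (hG.comp hc) ω'
  refine Eq.trans ?_ (this.trans ?_)
  · congr 1
  · rw [← uniformLaw_Iio ha1, ← lintegral_indicator_one measurableSet_Iio,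
      ← map_cdf_nodeLaw hρ hρ1 hρU f, lintegral_map hG hc]
    rfl

include hx hxV in
theorem prod_ofReal_rpow_expo (hxE : ∀ e : E, x e = 1 ∨ x e < rightWeight E x e.1.2) (e : E)
    (ω : Sample E) : ∏ f ∈ others e, ENNReal.ofReal (uniformVar E ρ e ω ^ expo x e f) =
      ENNReal.ofReal (powerVar x ρ e ω) := by
  rw [← ENNReal.ofReal_prod_of_nonneg fun f _ => Real.rpow_nonneg (uniformVar_nonneg E ρ e ω) _,
    ← Real.rpow_sum_of_nonneg (uniformVar_nonneg E ρ e ω) fun f hf => expo_nonneg hx hxV hf,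
    sum_expo hx hxE, powerVar]

/-- The thresholds live at nodes that are not integrated. Once they are frozen, each indicator is a
decreasing function of the single coordinate of `b p`, as negative association requires. -/
theorem lmarginal_prod_belowInd_freeze {I : Type*} (P : Finset I) (a b : I → E) {F : Finset U}
    (ha : ∀ p ∈ P, (a p).1.1 ∉ F) (ω : Sample E) :
    lmarginal (nodeLaw E ρ) F (fun ω => ∏ p ∈ P, belowInd x ρ (a p) (b p) ω ω) ω =
      lmarginal (nodeLaw E ρ) F (fun ω' => ∏ p ∈ P, belowInd x ρ (a p) (b p) ω ω') ω := by
  refine lintegral_congr fun y => Finset.prod_congr rfl fun p hp => ?_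
  have : uniformVar E ρ (a p) (Function.updateFinset ω F y) = uniformVar E ρ (a p) ω :=
    uniformVar_congr E ρ _ (by simp [Function.updateFinset, ha p hp])
  simp only [belowInd, this]

theorem lmarginal_powerVar {S : Finset E} {F : Finset U} (hS : ∀ e ∈ S, e.1.1 ∉ F) (ω : Sample E) :
    lmarginal (nodeLaw E ρ) F (fun ω => ∏ e ∈ S, ENNReal.ofReal (powerVar x ρ e ω)) ω =
      ∏ e ∈ S, ENNReal.ofReal (powerVar x ρ e ω) := by
  refine lmarginal_eq_self_of_dependsOn fun ω' h => Finset.prod_congr rfl fun e he => ?_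
  rw [powerVar, powerVar, uniformVar_congr E ρ e (h _ (hS e he))]

include hρ hρ1 hρU hx hxV

theorem lintegral_prod_belowInd_le (hxE : ∀ e : E, x e = 1 ∨ x e < rightWeight E x e.1.2)
    {S : Finset E} (hS : ∀ e ∈ S, ∀ f ∈ others e, ∀ e' ∈ S, f.1.1 ≠ e'.1.1)
    (hinj : ∀ e ∈ S, ∀ e' ∈ S, e.1.2 = e'.1.2 → e = e') :
    ∫⁻ ω, ∏ e ∈ S, ∏ f ∈ others e, belowInd x ρ e f ω ω ∂law E ρ ≤
      ∫⁻ ω, ∏ e ∈ S, ENNReal.ofReal (powerVar x ρ e ω) ∂law E ρ := by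
  -- Integrating over F conditions on the left-nodes of S. By `hS` every competitor has its
  -- left-node in F.
  set F : Finset U := (S.image fun e => e.1.1)ᶜ with hF
  have hSF : ∀ e ∈ S, e.1.1 ∉ F := fun e he => by
    simp only [hF, Finset.mem_compl, not_not]
    exact Finset.mem_image_of_mem (fun e : E => e.1.1) he
  have hfF : ∀ e ∈ S, ∀ f ∈ others e, f.1.1 ∈ F := fun e he f hf => by
    simp only [hF, Finset.mem_compl, Finset.mem_image, not_exists, not_and]
    exact fun e' he' h => hS e he f hf e' he' h.symm
  set P : Finset (Σ _ : E, E) := S.sigma fun e => others e with hP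
  have hPm : ∀ p ∈ P, p.1 ∈ S ∧ p.2 ∈ others p.1 := fun p hp => Finset.mem_sigma.1 hp
  have e1 : ∀ ω, ∏ e ∈ S, ∏ f ∈ others e, belowInd x ρ e f ω ω =
      ∏ p ∈ P, belowInd x ρ p.1 p.2 ω ω := fun ω => by
    rw [hP, Finset.prod_sigma]
  have m1 : Measurable fun ω : Sample E => ∏ p ∈ P, belowInd x ρ p.1 p.2 ω ω :=
    Finset.measurable_prod _ fun p _ => measurable_belowInd x ρ p.1 p.2
  have m2 : Measurable fun ω : Sample E => ∏ e ∈ S, ENNReal.ofReal (powerVar x ρ e ω) :=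
    Finset.measurable_prod _ fun e _ => (measurable_powerVar x ρ e).ennreal_ofReal
  simp only [e1]
  refine lintegral_le_of_lmarginal_le (μ := nodeLaw E ρ) F m1 m2 fun ω => ?_
  rw [lmarginal_powerVar hSF, lmarginal_prod_belowInd_freeze P (fun p => p.1) (fun p => p.2)
    fun p hp => hSF _ (hPm p hp).1]
  -- A competitor determines its right-node, hence by `hinj` the edge of S it competes with, so
  -- distinct pairs use distinct coordinates.
  have hdis : (P : Set (Σ _ : E, E)).PairwiseDisjoint fun p => coords E {p.2} := by
    intro p hp q hq hpq
    refine disjoint_coords E (Set.disjoint_singleton.2 fun h => hpq ?_)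
    have h1 := hPm p hp
    have h2 := hPm q hq
    have h3 : p.1 = q.1 := hinj _ h1.1 _ h2.1 (by
      rw [← (mem_others.1 h1.2).1, ← (mem_others.1 h2.2).1, h])
    obtain ⟨p1, p2⟩ := p
    obtain ⟨q1, q2⟩ := q
    simp only at h h3
    rw [h, h3]
  refine (lmarginal_prod_le (negAssocLaw_nodeLaw hρ hρU) P hdis
    (h := fun p => belowInd x ρ p.1 p.2 ω) (fun p => measurable_belowInd_right x ρ p.1 p.2 ω)
    (fun p ω' ω'' h => ?_) (.inr fun p => antitone_belowInd x ρ p.1 p.2 ω) F ω).trans ?_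
  · simp only [belowInd]
    rw [uniformVar_congr_of_coords E ρ h (Set.mem_singleton p.2)]
  · refine le_of_eq ?_
    rw [Finset.prod_congr rfl fun p hp => lmarginal_belowInd hρ hρ1 hρU hx hxV (hPm p hp).2
        (hfF _ (hPm p hp).1 _ (hPm p hp).2) ω ω, hP,
      Finset.prod_sigma _ _ fun p : (Σ _ : E, E) =>
        ENNReal.ofReal (uniformVar E ρ p.1 ω ^ expo x p.1 p.2)]
    exact Finset.prod_congr rfl fun e _ => prod_ofReal_rpow_expo hx hxV hxE e ω

/-- The competitors of a single edge sit at distinct left-nodes other than its own, so they are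
independent given A_e and equality holds. -/
theorem lintegral_prod_belowInd_eq (hxE : ∀ e : E, x e = 1 ∨ x e < rightWeight E x e.1.2) (e : E) :
    ∫⁻ ω, ∏ f ∈ others e, belowInd x ρ e f ω ω ∂law E ρ =
      ∫⁻ ω, ENNReal.ofReal (powerVar x ρ e ω) ∂law E ρ := by
  set F : Finset U := {e.1.1}ᶜ with hF
  have heF : e.1.1 ∉ F := by simp [hF]
  have hfF : ∀ f ∈ others e, f.1.1 ∈ F := fun f hf => by
    simp only [hF, Finset.mem_compl, Finset.mem_singleton]
    exact fun h => (mem_others.1 hf).2 (Subtype.ext (Prod.ext h (mem_others.1 hf).1))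
  refine lintegral_eq_of_lmarginal_eq (μ := nodeLaw E ρ) F
    (Finset.measurable_prod _ fun f _ => measurable_belowInd x ρ e f)
    (measurable_powerVar x ρ e).ennreal_ofReal (funext fun ω => ?_)
  have h1 := lmarginal_powerVar (x := x) (ρ := ρ) (S := {e}) (F := F) (by simpa using heF) ω
  simp only [Finset.prod_singleton] at h1
  rw [h1, lmarginal_prod_belowInd_freeze (others e) (fun _ => e) (fun f => f) fun _ _ => heF,
    lmarginal_prod_eq (μ := nodeLaw E ρ) (others e) (a := fun f => f.1.1)
      (h := fun f => belowInd x ρ e f ω) (fun f hf f' hf' h => Subtype.ext (Prod.ext h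
        ((mem_others.1 hf).1.trans (mem_others.1 hf').1.symm)))
      (fun f => measurable_belowInd_right x ρ e f ω) (fun f ω' ω'' h => by
        simp only [belowInd]
        rw [uniformVar_congr E ρ f (h _ rfl)]),
    Finset.prod_congr rfl fun f hf => lmarginal_belowInd hρ hρ1 hρU hx hxV hf (hfF f hf) ω ω]
  exact prod_ofReal_rpow_expo hx hxV hxE e ω

/-- For a uniform variable the q-th moment is 1 / (q + 1), and q = 1/x_e - 1. -/
theorem lintegral_powerVar (e : E) :
    ∫⁻ ω, ENNReal.ofReal (powerVar x ρ e ω) ∂law E ρ = ENNReal.ofReal (x e) := by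
  have h := lintegral_rpow_uniformLaw (inv_sub_one_nonneg hx hxV e)
  rw [← map_uniformVar hρ hρ1 hρU e, lintegral_map (by fun_prop) (measurable_uniformVar E ρ e)] at h
  refine h.trans ?_
  rw [sub_add_cancel, one_div_one_div]

/-- The powers are increasing functions of distinct negatively associated variables; stability is
not involved. -/
theorem lintegral_prod_powerVar_le (S : Finset E) :
    ∫⁻ ω, ∏ e ∈ S, ENNReal.ofReal (powerVar x ρ e ω) ∂law E ρ ≤ ∏ e ∈ S, ENNReal.ofReal (x e) := by
  have h := lmarginal_prod_le (μ := nodeLaw E ρ) (negAssocLaw_nodeLaw hρ hρU) S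
    (s := fun e => coords E {e})
    (fun e _ f _ hef => disjoint_coords E (Set.disjoint_singleton.2 hef))
    (h := fun e ω => ENNReal.ofReal (powerVar x ρ e ω))
    (fun e => (measurable_powerVar x ρ e).ennreal_ofReal)
    (fun e ω ω' h => by
      simp only [powerVar]
      rw [uniformVar_congr_of_coords E ρ h (Set.mem_singleton e)])
    (.inl fun e ω ω' h => ENNReal.ofReal_le_ofReal (Real.rpow_le_rpow (uniformVar_nonneg E ρ e ω)
      (monotone_uniformVar E ρ e h) (inv_sub_one_nonneg hx hxV e))) Finset.univ 0
  simp only [lmarginal_univ] at h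
  exact h.trans_eq (Finset.prod_congr rfl fun e _ => lintegral_powerVar hρ hρ1 hρU hx hxV e)

/-! ### Marginals of X and correlation bounds -/

theorem ofReal_X_ae_eq : ∀ᵐ ω ∂law E ρ, ∀ e,
    ENNReal.ofReal (X E x ρ e ω) = ∏ f ∈ others e, belowInd x ρ e f ω ω := by
  filter_upwards [A_ae_eq_and_mem_Ioo hρ hρ1 hρU] with ω hω e
    using ofReal_X_eq_prod_belowInd hx hω e

omit hρ hρ1 hρU hx hxV in
theorem X_mem (x ρ : E → ℝ) (e : E) (ω : Sample E) : X E x ρ e ω = 0 ∨ X E x ρ e ω = 1 := by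
  unfold X
  split_ifs
  · exact .inr rfl
  · exact .inl rfl

omit hρ hρ1 hρU hx hxV in
theorem X_nonneg (x ρ : E → ℝ) (e : E) (ω : Sample E) : 0 ≤ X E x ρ e ω := by
  rcases X_mem x ρ e ω with h | h <;> rw [h]
  exact zero_le_one

theorem aemeasurable_X (e : E) : AEMeasurable (X E x ρ e) (law E ρ) := by
  have h : Measurable fun ω : Sample E => (∏ f ∈ others e, belowInd x ρ e f ω ω).toReal :=
    (Finset.measurable_prod _ fun f _ => measurable_belowInd x ρ e f).ennreal_toReal
  refine ⟨_, h, ?_⟩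
  filter_upwards [ofReal_X_ae_eq hρ hρ1 hρU hx hxV] with ω hω
  rw [← hω e, ENNReal.toReal_ofReal (X_nonneg x ρ e ω)]

theorem measureReal_X_eq_one (hxE : ∀ e : E, x e = 1 ∨ x e < rightWeight E x e.1.2) (e : E) :
    (law E ρ).real {ω | X E x ρ e ω = 1} = x e := by
  have h : law E ρ {ω | X E x ρ e ω = 1} = ENNReal.ofReal (x e) := by
    rw [← lintegral_powerVar hρ hρ1 hρU hx hxV e, ← lintegral_prod_belowInd_eq hρ hρ1 hρU hx hxV hxE]
    have hn : NullMeasurableSet {ω | X E x ρ e ω = 1} (law E ρ) :=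
      (aemeasurable_X hρ hρ1 hρU hx hxV e).nullMeasurableSet_preimage (measurableSet_singleton 1)
    rw [← lintegral_indicator_one₀ hn]
    refine lintegral_congr_ae ?_
    filter_upwards [ofReal_X_ae_eq hρ hρ1 hρU hx hxV] with ω hω
    rw [← hω e]
    rcases X_mem x ρ e ω with h | h
    · rw [Set.indicator_of_notMem (by simp [h]), h, ENNReal.ofReal_zero]
    · rw [Set.indicator_of_mem (by simpa using h), h, ENNReal.ofReal_one, Pi.one_apply]
  rw [measureReal_def, h, ENNReal.toReal_ofReal (hx e).le]

theorem ae_eq_of_X_eq_one : ∀ᵐ ω ∂law E ρ, ∀ e f : E, e.1.2 = f.1.2 →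
    X E x ρ e ω = 1 → X E x ρ f ω = 1 → e = f := by
  filter_upwards [A_ae_eq_and_mem_Ioo hρ hρ1 hρU] with ω hω e f hef he hf
  exact eq_of_X_eq_one hx hxV (fun e => Z_nonneg hx (by rw [(hω e).1]; exact (hω e).2)) hef he hf

-- Were f and e' to share a left-node, e, f, e' would be a path in the line graph. Its ends are
-- distinct and not adjacent: a common right-node contradicts `hinj`, a common left-node would force
-- f = e. So they would be at distance exactly two.
omit hρ hρ1 hρU hx hxV in
theorem StableEdgeSet.left_ne {S : Finset E} (hS : StableEdgeSet E S)
    (hinj : ∀ e ∈ S, ∀ e' ∈ S, e.1.2 = e'.1.2 → e = e') :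
    ∀ e ∈ S, ∀ f ∈ others e, ∀ e' ∈ S, f.1.1 ≠ e'.1.1 := by
  intro e he f hf e' he' hfe'
  obtain ⟨hf2, hfe⟩ := mem_others.1 hf
  have hee' : e ≠ e' := by
    rintro rfl
    exact hfe (Subtype.ext (Prod.ext hfe' hf2))
  have hfe'' : f ≠ e' := by
    rintro rfl
    exact hee' (hinj e he f he' hf2.symm)
  have h1 : (edgeLineGraph E).Adj e f := ⟨hfe.symm, .inr hf2.symm⟩
  have h2 : (edgeLineGraph E).Adj f e' := ⟨hfe'', .inl hfe'⟩
  have hw : (edgeLineGraph E).dist e e' ≤ 2 :=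
    (edgeLineGraph E).dist_le (.cons h1 (.cons h2 .nil))
  have hr : (edgeLineGraph E).Reachable e e' := h1.reachable.trans h2.reachable
  have h0 : (edgeLineGraph E).dist e e' ≠ 0 := fun h => hee' (hr.dist_eq_zero_iff.1 h)
  have hd1 : (edgeLineGraph E).dist e e' ≠ 1 := by
    intro h
    rcases (SimpleGraph.dist_eq_one_iff_adj.1 h).2 with h | h
    · exact hfe (Subtype.ext (Prod.ext (hfe'.trans h.symm) hf2))
    · exact hee' (hinj e he e' he' h)
  have := hS e he e' he'
  omega

theorem prod_A_ae_eq (S : Finset E) : (fun ω => ∏ e ∈ S, A E ρ e ω ^ (1 / x e - 1)) =ᵐ[law E ρ]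
    fun ω => ∏ e ∈ S, powerVar x ρ e ω := by
  filter_upwards [A_ae_eq_and_mem_Ioo hρ hρ1 hρU] with ω hω
  exact Finset.prod_congr rfl fun e _ => by rw [powerVar, (hω e).1]

theorem integrable_prod_powerVar (S : Finset E) :
    Integrable (fun ω => ∏ e ∈ S, powerVar x ρ e ω) (law E ρ) := by
  refine ⟨(Finset.measurable_prod _ fun e _ => measurable_powerVar x ρ e).aestronglyMeasurable, ?_⟩
  rw [hasFiniteIntegral_iff_ofReal
    (.of_forall fun ω => Finset.prod_nonneg fun e _ => powerVar_nonneg x ρ e ω)]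
  simp only [ENNReal.ofReal_prod_of_nonneg fun e _ => powerVar_nonneg x ρ e _]
  exact (lintegral_prod_powerVar_le hρ hρ1 hρU hx hxV S).trans_lt
    (ENNReal.prod_lt_top fun e _ => ENNReal.ofReal_lt_top)

theorem integrable_prod_X (S : Finset E) :
    Integrable (fun ω => ∏ e ∈ S, X E x ρ e ω) (law E ρ) := by
  refine Integrable.of_bound (Finset.aemeasurable_fun_prod S fun e _ =>
    aemeasurable_X hρ hρ1 hρU hx hxV e).aestronglyMeasurable 1 (.of_forall fun ω => ?_)
  rw [Real.norm_of_nonneg (Finset.prod_nonneg fun e _ => X_nonneg x ρ e ω)]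
  refine Finset.prod_le_one (fun e _ => X_nonneg x ρ e ω) fun e _ => ?_
  rcases X_mem x ρ e ω with h | h <;> rw [h]
  exact zero_le_one

theorem integral_prod_X_le (hxE : ∀ e : E, x e = 1 ∨ x e < rightWeight E x e.1.2) {S : Finset E}
    (hS : StableEdgeSet E S) : ∫ ω, ∏ e ∈ S, X E x ρ e ω ∂law E ρ ≤
      ∫ ω, ∏ e ∈ S, A E ρ e ω ^ (1 / x e - 1) ∂law E ρ := by
  rw [integral_congr_ae (prod_A_ae_eq hρ hρ1 hρU hx hxV S)]
  have nX : ∀ ω, 0 ≤ ∏ e ∈ S, X E x ρ e ω := fun ω =>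
    Finset.prod_nonneg fun e _ => X_nonneg x ρ e ω
  have nP : ∀ ω, 0 ≤ ∏ e ∈ S, powerVar x ρ e ω := fun ω =>
    Finset.prod_nonneg fun e _ => powerVar_nonneg x ρ e ω
  by_cases hinj : ∀ e ∈ S, ∀ e' ∈ S, e.1.2 = e'.1.2 → e = e'
  · rw [← ENNReal.ofReal_le_ofReal_iff (integral_nonneg nP), ofReal_integral_eq_lintegral_ofReal
        (integrable_prod_X hρ hρ1 hρU hx hxV S) (.of_forall nX),
      ofReal_integral_eq_lintegral_ofReal
        (integrable_prod_powerVar hρ hρ1 hρU hx hxV S) (.of_forall nP)]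
    have h := lintegral_prod_belowInd_le hρ hρ1 hρU hx hxV hxE
      (StableEdgeSet.left_ne hS hinj) hinj
    refine (le_of_eq (lintegral_congr_ae ?_)).trans (h.trans (le_of_eq ?_))
    · filter_upwards [ofReal_X_ae_eq hρ hρ1 hρU hx hxV] with ω hω
      rw [ENNReal.ofReal_prod_of_nonneg fun e _ => X_nonneg x ρ e ω]
      exact Finset.prod_congr rfl fun e _ => hω e
    · exact lintegral_congr fun ω =>
        (ENNReal.ofReal_prod_of_nonneg fun e _ => powerVar_nonneg x ρ e ω).symm
  -- Two edges of S at one right-node are almost surely never both selected, so the left side is 0.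
  · push Not at hinj
    obtain ⟨e, he, e', he', hv, hne⟩ := hinj
    rw [integral_eq_zero_of_ae]
    · exact integral_nonneg nP
    · filter_upwards [ae_eq_of_X_eq_one hρ hρ1 hρU hx hxV] with ω hω
      rcases X_mem x ρ e ω with h | h
      · exact Finset.prod_eq_zero he h
      · rcases X_mem x ρ e' ω with h' | h'
        · exact Finset.prod_eq_zero he' h'
        · exact absurd (hω e e' hv h h') hne

theorem integral_prod_A_le (S : Finset E) :
    ∫ ω, ∏ e ∈ S, A E ρ e ω ^ (1 / x e - 1) ∂law E ρ ≤ ∏ e ∈ S, x e := by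
  have nP : ∀ ω, 0 ≤ ∏ e ∈ S, powerVar x ρ e ω := fun ω =>
    Finset.prod_nonneg fun e _ => powerVar_nonneg x ρ e ω
  rw [integral_congr_ae (prod_A_ae_eq hρ hρ1 hρU hx hxV S),
    ← ENNReal.ofReal_le_ofReal_iff (Finset.prod_nonneg fun e _ => (hx e).le),
    ofReal_integral_eq_lintegral_ofReal (integrable_prod_powerVar hρ hρ1 hρU hx hxV S)
      (.of_forall nP), ENNReal.ofReal_prod_of_nonneg fun e _ => (hx e).le]
  simp only [ENNReal.ofReal_prod_of_nonneg fun e _ => powerVar_nonneg x ρ e _]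
  exact lintegral_prod_powerVar_le hρ hρ1 hρU hx hxV S

-- The two edges are adjacent in the line graph, so the only distances are 0 and 1.
omit hρ hρ1 hρU hx hxV in
theorem stableEdgeSet_pair {e₁ e₂ : E} (hne : e₁ ≠ e₂) (h : e₁.1.1 = e₂.1.1) :
    StableEdgeSet E {e₁, e₂} := by
  have h1 : (edgeLineGraph E).dist e₁ e₂ = 1 :=
    SimpleGraph.dist_eq_one_iff_adj.2 ⟨hne, .inl h⟩
  have h2 : (edgeLineGraph E).dist e₂ e₁ = 1 := by rw [SimpleGraph.dist_comm, h1]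
  intro e he f hf
  simp only [Finset.mem_insert, Finset.mem_singleton] at he hf
  rcases he with rfl | rfl <;> rcases hf with rfl | rfl <;> simp [h1, h2]

/-- The total parameter at the node is 1, so the pair (T_e₁, T_e₂) has exactly the Dirichlet law
appearing in `Psi`. -/
theorem integral_A_mul_A {e₁ e₂ : E} (hne : e₁ ≠ e₂) (h : e₁.1.1 = e₂.1.1) :
    ∫ ω, A E ρ e₁ ω ^ (1 / x e₁ - 1) * A E ρ e₂ ω ^ (1 / x e₂ - 1) ∂law E ρ =
      x e₁ * x e₂ * Psi (x e₁) (x e₂) (ρ e₁) (ρ e₂) := by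
  have hx1 := (hx e₁).ne'
  have hx2 := (hx e₂).ne'
  rw [Psi, mul_div_cancel₀ _ (mul_ne_zero hx1 hx2)]
  set u := e₁.1.1 with hu
  set j : Fin 2 → LeftNbr E u := ![⟨e₁, rfl⟩, ⟨e₂, h.symm⟩] with hj
  have hjinj : j.Injective := by
    intro a b hab
    fin_cases a <;> fin_cases b <;> simp_all
  have hmap := map_comp_injective_dirichlet hjinj (ρ := fun e : LeftNbr E u => ρ e)
    (fun e => (hρ e).le) (sub_nonneg.2 (hρU u))
  have hparam : (fun e : LeftNbr E u => ρ e) ∘ j = ![ρ e₁, ρ e₂] := by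
    ext k; fin_cases k <;> rfl
  have hlast : ∑ e : LeftNbr E u, ρ e - ∑ k, ρ (j k) + (1 - ∑ e : LeftNbr E u, ρ e) =
      1 - ρ e₁ - ρ e₂ := by
    rw [Fin.sum_univ_two]
    simp only [hj, Matrix.cons_val_zero, Matrix.cons_val_one]
    ring
  change (nodeLaw E ρ u).map _ = _ at hmap
  rw [hparam, hlast, ← map_node_law ρ u, Measure.map_map (by fun_prop) (by fun_prop)] at hmap
  set c₁ := cdf (betaMeasure (ρ e₁) (1 - ρ e₁))
  set c₂ := cdf (betaMeasure (ρ e₂) (1 - ρ e₂))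
  -- `T` reads the coordinate at the left-node of `e₂`, which equals `u` only propositionally, so
  -- the index is transported along `h`.
  have hT2 : ∀ ω : Sample E, T E e₂ ω = ω u (j 1) := by
    intro ω
    have : ∀ (w : U) (hw : e₂.1.1 = w), ω e₂.1.1 ⟨e₂, rfl⟩ = ω w ⟨e₂, hw⟩ := by
      rintro _ rfl; rfl
    exact this u h.symm
  have hae : ∀ᵐ t ∂dirichlet ![ρ e₁, ρ e₂] (1 - ρ e₁ - ρ e₂),
      regIncompleteBeta (t 0) (ρ e₁) (1 - ρ e₁) ^ (1 / x e₁ - 1) *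
        regIncompleteBeta (t 1) (ρ e₂) (1 - ρ e₂) ^ (1 / x e₂ - 1) =
      c₁ (t 0) ^ (1 / x e₁ - 1) * c₂ (t 1) ^ (1 / x e₂ - 1) := by
    filter_upwards [dirichlet_ae_mem_Icc ![ρ e₁, ρ e₂] (1 - ρ e₁ - ρ e₂)] with t ht
    rw [regIncompleteBeta_eq_cdf (hρ e₁) (sub_pos.2 (hρ1 e₁)) (ht 0),
      regIncompleteBeta_eq_cdf (hρ e₂) (sub_pos.2 (hρ1 e₂)) (ht 1)]
  have hm : Measurable fun t : Fin 2 → ℝ =>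
      c₁ (t 0) ^ (1 / x e₁ - 1) * c₂ (t 1) ^ (1 / x e₂ - 1) := by
    have h1 : Measurable c₁ := (monotone_cdf _).measurable
    have h2 : Measurable c₂ := (monotone_cdf _).measurable
    fun_prop
  have hjm : Measurable ((fun t : LeftNbr E u → ℝ => t ∘ j) ∘ fun ω : Sample E => ω u) :=
    measurable_pi_iff.2 fun k => (measurable_pi_apply (j k)).comp (measurable_pi_apply u)
  rw [integral_congr_ae hae, ← hmap, integral_map hjm.aemeasurable hm.aestronglyMeasurable]
  refine integral_congr_ae ?_
  filter_upwards [A_ae_eq_and_mem_Ioo hρ hρ1 hρU] with ω hω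
  rw [(hω e₁).1, (hω e₂).1, uniformVar, uniformVar, hT2]
  rfl

end Main

end DepRound

end

theorem mainTheorem2 {U V : Type*} [Fintype U] [Fintype V] [DecidableEq U] [DecidableEq V]
    (E : Finset (U × V)) (x ρ : E → ℝ)
    (hx : ∀ e, 0 < x e) (hxV : ∀ v : V, DepRound.rightWeight E x v ≤ 1)
    (hxE : ∀ e : E, x e = 1 ∨ x e < DepRound.rightWeight E x e.1.2)
    (hρ : ∀ e, 0 < ρ e) (hρ1 : ∀ e, ρ e < 1)
    (hρU : ∀ u : U, ∑ e : LeftNbr E u, ρ e ≤ 1) :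
    -- the random choices are drawn from a probability distribution
    IsProbabilityMeasure (DepRound.law E ρ) ∧
    -- the `Z_e` at a right-node are independent exponentials of rates `x_e`
    (∀ v : V,
      iIndepFun (fun e : RightNbr E v => DepRound.Z E x ρ e) (DepRound.law E ρ) ∧
      ∀ e : RightNbr E v,
        HasLaw (DepRound.Z E x ρ e) (expMeasure (x e)) (DepRound.law E ρ)) ∧
    -- the `A_e` are negatively associated
    NegativelyAssociated (DepRound.A E ρ) (DepRound.law E ρ) ∧
    -- the marginals are preserved
    (∀ e : E, (DepRound.law E ρ).real {ω | DepRound.X E x ρ e ω = 1} = x e) ∧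
    -- every right-node has at most one selected edge
    (∀ᵐ ω ∂(DepRound.law E ρ), ∀ e f : E, e.1.2 = f.1.2 →
      DepRound.X E x ρ e ω = 1 → DepRound.X E x ρ f ω = 1 → e = f) ∧
    -- correlation bounds for stable edge sets
    (∀ S : Finset E, StableEdgeSet E S →
      Integrable (fun ω => ∏ e ∈ S, DepRound.X E x ρ e ω) (DepRound.law E ρ) ∧
      Integrable (fun ω => ∏ e ∈ S, DepRound.A E ρ e ω ^ (1 / x e - 1)) (DepRound.law E ρ) ∧
      ∫ ω, ∏ e ∈ S, DepRound.X E x ρ e ω ∂(DepRound.law E ρ) ≤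
        ∫ ω, ∏ e ∈ S, DepRound.A E ρ e ω ^ (1 / x e - 1) ∂(DepRound.law E ρ) ∧
      ∫ ω, ∏ e ∈ S, DepRound.A E ρ e ω ^ (1 / x e - 1) ∂(DepRound.law E ρ) ≤ ∏ e ∈ S, x e) ∧
    -- strong negative correlation of two edges at a left-node
    (∀ e₁ e₂ : E, e₁ ≠ e₂ → e₁.1.1 = e₂.1.1 →
      ∫ ω, DepRound.X E x ρ e₁ ω * DepRound.X E x ρ e₂ ω ∂(DepRound.law E ρ) ≤
        x e₁ * x e₂ * Psi (x e₁) (x e₂) (ρ e₁) (ρ e₂)) := by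
  refine ⟨inferInstance, fun v => ⟨DepRound.iIndepFun_Z hρ hρ1 hρU x v,
      fun e => DepRound.hasLaw_Z hρ hρ1 hρU hx e⟩,
    DepRound.negativelyAssociated_A hρ hρ1 hρU,
    DepRound.measureReal_X_eq_one hρ hρ1 hρU hx hxV hxE,
    DepRound.ae_eq_of_X_eq_one hρ hρ1 hρU hx hxV,
    fun S hS => ⟨DepRound.integrable_prod_X hρ hρ1 hρU hx hxV S,
      (DepRound.integrable_prod_powerVar hρ hρ1 hρU hx hxV S).congr
        (DepRound.prod_A_ae_eq hρ hρ1 hρU hx hxV S).symm,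
      DepRound.integral_prod_X_le hρ hρ1 hρU hx hxV hxE hS,
      DepRound.integral_prod_A_le hρ hρ1 hρU hx hxV S⟩,
    fun e₁ e₂ hne h => ?_⟩
  have hle := DepRound.integral_prod_X_le hρ hρ1 hρU hx hxV hxE
    (DepRound.stableEdgeSet_pair hne h)
  simp only [Finset.prod_pair hne] at hle
  exact hle.trans_eq (DepRound.integral_A_mul_A hρ hρ1 hρU hx hxV hne h)
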